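/- Let $B$ be a connected manifold with universal covering $\widetilde B\to B$ and base point $b$, so that $\pi_1(B)=\pi_1(B,b)$ acts on $\widetilde B$ by deck transformations. Let $\rho:\pi_1(B)\to \mathrm{GL}(d,\mathbb Z)$ be a homomorphism, $\Lambda=\mathbb Z^d$, $T=\mathbb R^d/\Lambda$, and let $M=\widetilde B\times_\rho T$ be the flat torus bundle over $B$ with holonomy $\rho$. Then $\pi_1(M)$ (based at the zero section over $b$) is the crossed product $\Lambda\rtimes_{\rho}\pi_1(B)$, the deck group of $\widetilde B\times\mathbb R^d\to M$, where $(a,\gamma)$ acts by $(x,y)\mapsto(\gamma x,\rho(\gamma)y+a)$. Let $\widehat T=\mathrm{Hom}(\Lambda,\mathrm U(1))$ be the dual torus with the action $(\gamma\xi)(a)=\xi(\rho(\gamma)^{-1}a)$ of $\pi_1(B)$, and let $\Gamma_{\rho,\xi}\subset\pi_1(B)$ be the isotropy group of $\xi\in\widehat T$. For $n\ge 1$ let $\mathcal R_M(n)$ be the set of irreducible representations $\pi_1(M)\to\mathrm U(n)$ modulo conjugation in $\mathrm U(n)$. If the orbit of $\xi$ has finite order $\ell$, then $\Gamma_{\rho,\xi}\subset\pi_1(B)$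 and $\Lambda\rtimes\Gamma_{\rho,\xi}\subset\pi_1(M)$ have index $\ell$, and for $\eta:\Gamma_{\rho,\xi}\to\mathrm U(k)$ the formula $(\exp\xi,\eta)(a,\gamma)=\xi(a)\,\eta(\gamma)$ defines a unitary representation of $\Lambda\rtimes\Gamma_{\rho,\xi}$. The set $\mathcal R_M(n)$ is parametrized by the following data: (1) orbits $[\xi]\in\pi_1(B)\backslash\widehat T$ of finite order $\ell$ with $\ell\mid n$; (2) irreducible representations $\eta:\Gamma_{\rho,\xi}\to\mathrm U(k)$, $k=n/\ell$, up to conjugation in $\mathrm U(k)$. To these data corresponds the class of the unitary representation of $\pi_1(M)$ induced from $(\exp\xi,\eta)$. That is, this induced representation is an irreducible $\mathrm U(n)$-representation, and for every choice of representatives $\xi$ of the orbits, induction defines a bijection from the set of pairs $([\xi],[\eta])$ onto $\mathcal R_M(n)$; moreover, the induced representation does not change if $\xi$ is replaced by $\gamma\xi$, $\gamma\in\pi_1(B)$, and $\eta$ by the representation $\gamma h\gamma^{-1}\mapsto\eta(h)$ of $\Gamma_{\rho,\gamma\xi}=\gamma\Gamma_{\rho,\xi}\gamma^{-1}$. In the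 generic case $\ell=n$, $k=1$, induction yields exactly the classes in $\mathcal R_M(n)^n$, that is, the irreducible representations whose restriction to $\Lambda$ contains $n$ distinct characters. The induction corresponds to the inverse Fourier–Mukai transform: let $\widehat M=\widetilde B\times_{\rho^*}\widehat T$ be the dual bundle, $\Sigma\subset\widehat M$ the image of $\widetilde B\times\{\xi\}$ (a covering of $B$ with $\ell$ sheets), $\mathcal S_\eta$ the flat vector bundle on $\Sigma\cong\widetilde B/\Gamma_{\rho,\xi}$ associated to an irreducible $\eta:\Gamma_{\rho,\xi}\to\mathrm U(k)$ with $\ell k=n$, $Z_\Sigma=M\times_B\Sigma$ with projections $p_\Sigma:Z_\Sigma\to M$, $\hat p_\Sigma:Z_\Sigma\to\Sigma$, and $\mathcal P_\Sigma$ the restriction to $Z_\Sigma$ of the relative Poincaré line bundle on $M\times_B\widehat M$, which is flat on $Z_\Sigma$. Then the flat bundle $p_{\Sigma,*}(\hat p_\Sigma^*\mathcal S_\eta\otimes\mathcal P_\Sigma)$ on $M$ is isomorphic to the flat bundle associated to the representation of $\pi_1(M)$ induced from $(\exp\xi,\eta)$. -/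

import Mathlib

open scoped MatrixGroups TensorProduct Topology

noncomputable section

namespace TorusBundle

universe u v

/-! ### Fundamental groups, unitary representations, representation varieties -/

/-- The fundamental group with concatenation of loops as product (first the left factor, then the
right factor); Mathlib's `FundamentalGroup` multiplies in the opposite order. -/
abbrev Pi1 (Y : Type*) [TopologicalSpace Y] (y : Y) := (FundamentalGroup Y y)ᵐᵒᵖ

/-- The group `U(n)`. -/
abbrev U (n : ℕ) := Matrix.unitaryGroup (Fin n) ℂ

section Representations

variable {G : Type*} [Group G] {n : ℕ}

/-- The linear representation on `ℂⁿ` given by a homomorphism to `U(n)`. -/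
def toRep (τ : G →* U n) : Representation ℂ G (Fin n → ℂ) :=
  ((Matrix.toLinAlgEquiv' (R := ℂ) (n := Fin n)).toAlgHom.toRingHom.toMonoidHom.comp
    (Submonoid.subtype _)).comp τ

/-- Irreducibility of a unitary representation. -/
def IsIrr (τ : G →* U n) : Prop := (toRep τ).IsIrreducible

/-- Irreducible `U(n)`-representations up to conjugation in `U(n)`. -/
def conjSetoid (G : Type*) [Group G] (n : ℕ) : Setoid {τ : G →* U n // IsIrr τ} where
  r τ τ' := ∃ u : U n, ∀ g, τ'.1 g = u * τ.1 g * u⁻¹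
  iseqv :=
    { refl := fun τ => ⟨1, fun g => by simp⟩
      symm := fun {τ τ'} ⟨u, hu⟩ => ⟨u⁻¹, fun g => by rw [hu g]; group⟩
      trans := fun {τ τ' τ''} ⟨u, hu⟩ ⟨w, hw⟩ => ⟨w * u, fun g => by rw [hw g, hu g]; group⟩ }

/-- The representation variety: irreducible homomorphisms `G → U(n)` modulo conjugation. -/
def RepVar (G : Type*) [Group G] (n : ℕ) := Quotient (conjSetoid G n)

/-- The point of the representation variety given by an irreducible representation. -/
def RepVar.mk (τ : G →* U n) (h : IsIrr τ) : RepVar G n := Quotient.mk (conjSetoid G n) ⟨τ, h⟩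

/-- `τ : G → U(n)` is (unitarily equivalent to) the representation induced from the
representation `σ : H → U(k)` of the subgroup `H`: the space of the induced representation consists
of the functions `f : G → ℂᵏ` with `f (h g) = σ(h) f(g)`, on which `G` acts by right translation,
with the norm `‖f‖² = ∑_{H g ∈ H \ G} ‖f g‖²` (used here only for `H` of finite index). -/
def IsInducedFrom (H : Subgroup G) {k : ℕ} (σ : H →* U k) (τ : G →* U n) : Prop :=
  ∃ e : (Fin n → ℂ) ≃ₗ[ℂ] Representation.coindV H.subtype (toRep σ),
    (∀ g v, e (toRep τ g v) = Representation.coind H.subtype (toRep σ) g (e v)) ∧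
    ∀ v : Fin n → ℂ, ∑ i, ‖v i‖ ^ 2 =
      ∑ᶠ c : Quotient (QuotientGroup.rightRel H), ∑ j, ‖(e v).1 c.out j‖ ^ 2

end Representations

/-! ### The lattice, the crossed product, the dual torus -/

/-- The lattice `Λ = ℤᵈ`, written multiplicatively. -/
abbrev Lattice (d : ℕ) := Multiplicative (Fin d → ℤ)

variable {Γ : Type v} [Group Γ] {d : ℕ}

/-- The automorphism of `Λ` given by an element of `GL(d, ℤ)`. -/
def latticeAut (d : ℕ) : GL (Fin d) ℤ →* MulAut (Lattice d) where
  toFun A :=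
    { toFun := fun a => .ofAdd (A.1.mulVec a.toAdd)
      invFun := fun a => .ofAdd ((A⁻¹).1.mulVec a.toAdd)
      left_inv := fun a => by
        simp only [toAdd_ofAdd, Matrix.mulVec_mulVec]
        rw [← Units.val_mul, inv_mul_cancel]; simp
      right_inv := fun a => by
        simp only [toAdd_ofAdd, Matrix.mulVec_mulVec]
        rw [← Units.val_mul, mul_inv_cancel]; simp
      map_mul' := fun a b => by simp [Matrix.mulVec_add] }
  map_one' := by ext a; simp
  map_mul' A B := by
    apply MulEquiv.ext
    intro a
    simp [MulAut.mul_apply, Matrix.mulVec_mulVec]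

/-- The action `ρ_*` of `Γ` on `Λ`. -/
def latticeAct (ρ : Γ →* GL (Fin d) ℤ) : Γ →* MulAut (Lattice d) := (latticeAut d).comp ρ

/-- The crossed product of `Λ` and `Γ`, with `(a, γ) (b, δ) = (a + ρ(γ) b, γ δ)`. -/
abbrev Crossed (ρ : Γ →* GL (Fin d) ℤ) := Lattice d ⋊[latticeAct ρ] Γ

/-- The dual torus `Hom(Λ, U(1))`; the parameter `ρ` only records the action of `Γ`. -/
def DualTorus (_ρ : Γ →* GL (Fin d) ℤ) : Type := Lattice d →* Circle

/-- The character `exp ξ : Λ → U(1)`. -/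
def DualTorus.char {ρ : Γ →* GL (Fin d) ℤ} (ξ : DualTorus ρ) : Lattice d →* Circle := ξ

/-- The topology of pointwise convergence. -/
instance (ρ : Γ →* GL (Fin d) ℤ) : TopologicalSpace (DualTorus ρ) :=
  TopologicalSpace.induced (fun ξ (a : Lattice d) => ξ.char a) inferInstance

/-- The dual action `ρ^*`: `(γ ξ)(a) = ξ(ρ(γ)⁻¹ a)`. -/
instance (ρ : Γ →* GL (Fin d) ℤ) : MulAction Γ (DualTorus ρ) where
  smul γ ξ := ξ.char.comp (latticeAct ρ γ⁻¹).toMonoidHom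
  one_smul ξ := by
    apply MonoidHom.ext
    intro a
    change ξ.char (latticeAct ρ 1⁻¹ a) = ξ.char a
    simp
  mul_smul γ δ ξ := by
    apply MonoidHom.ext
    intro a
    change ξ.char (latticeAct ρ (γ * δ)⁻¹ a) = ξ.char (latticeAct ρ δ⁻¹ (latticeAct ρ γ⁻¹ a))
    simp [MulAut.mul_apply]

/-- The isotropy group `Γ_{ρ,ξ}`. -/
abbrev Isotropy {ρ : Γ →* GL (Fin d) ℤ} (ξ : DualTorus ρ) : Subgroup Γ := MulAction.stabilizer Γ ξ

/-- The subgroup of the crossed product consisting of the `(a, γ)` with `γ ∈ Γ_{ρ,ξ}`. -/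
def crossedIsotropy {ρ : Γ →* GL (Fin d) ℤ} (ξ : DualTorus ρ) : Subgroup (Crossed ρ) :=
  (Isotropy ξ).comap SemidirectProduct.rightHom

theorem char_latticeAct {ρ : Γ →* GL (Fin d) ℤ} (ξ : DualTorus ρ) {γ : Γ} (h : γ ∈ Isotropy ξ)
    (a : Lattice d) : ξ.char (latticeAct ρ γ a) = ξ.char a := by
  have h' : γ⁻¹ • ξ = ξ := (Isotropy ξ).inv_mem h
  have h2 : (γ⁻¹ • ξ).char a = ξ.char a := by rw [h']
  have h3 : (γ⁻¹ • ξ).char a = ξ.char (latticeAct ρ γ⁻¹⁻¹ a) := rfl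
  rw [← h2, h3, inv_inv]

/-- The scalar matrix with entry `z`, as an element of `U(k)`. -/
def scalarU (k : ℕ) : Circle →* U k where
  toFun z := ⟨Matrix.scalar (Fin k) (z : ℂ), by
    rw [Matrix.mem_unitaryGroup_iff]
    simp [Matrix.star_eq_conjTranspose, Matrix.diagonal_conjTranspose, Complex.mul_conj]⟩
  map_one' := by ext; simp
  map_mul' z w := by
    apply Subtype.ext
    simp

/-- The representation `(exp ξ, η) : (a, γ) ↦ ξ(a) η(γ)` of the subgroup `crossedIsotropy ξ`. -/
def expRep {ρ : Γ →* GL (Fin d) ℤ} (ξ : DualTorus ρ) {k : ℕ} (η : Isotropy ξ →* U k) :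
    crossedIsotropy ξ →* U k where
  toFun g := scalarU k (ξ.char g.1.left) * η ⟨g.1.right, g.2⟩
  map_one' := by
    have : (⟨((1 : crossedIsotropy ξ) : Crossed ρ).right, (1 : crossedIsotropy ξ).2⟩ :
      Isotropy ξ) = 1 := rfl
    rw [this]; simp
  map_mul' g h := by
    have e1 : (⟨((g * h : crossedIsotropy ξ) : Crossed ρ).right, (g * h).2⟩ : Isotropy ξ) =
      ⟨g.1.right, g.2⟩ * ⟨h.1.right, h.2⟩ := rfl
    have e2 : ξ.char ((g * h : crossedIsotropy ξ) : Crossed ρ).left =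
        ξ.char g.1.left * ξ.char h.1.left := by
      have : ((g * h : crossedIsotropy ξ) : Crossed ρ).left =
        g.1.left * latticeAct ρ g.1.right h.1.left := rfl
      rw [this, map_mul, char_latticeAct ξ (γ := g.1.right) g.2]
    have comm : ∀ (z : Circle) (u : U k), u * scalarU k z = scalarU k z * u := by
      intro z u
      apply Subtype.ext
      change u.1 * Matrix.scalar (Fin k) (z : ℂ) = Matrix.scalar (Fin k) (z : ℂ) * u.1
      exact ((Matrix.scalar_commute (z : ℂ) (fun _ => Commute.all _ _) u.1).eq).symm
    rw [e1, e2, map_mul, map_mul, mul_assoc, mul_assoc]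
    congr 1
    rw [← mul_assoc, ← mul_assoc, comm]

/-- `τ` is the representation of the crossed product induced from `(exp ξ, η)`. -/
def IsInd {ρ : Γ →* GL (Fin d) ℤ} (ξ : DualTorus ρ) {k n : ℕ} (η : Isotropy ξ →* U k)
    (τ : Crossed ρ →* U n) : Prop :=
  IsInducedFrom (crossedIsotropy ξ) (expRep ξ η) τ

/-- The order of an orbit in the dual torus (`0` if the orbit is infinite). -/
def orbitOrder {ρ : Γ →* GL (Fin d) ℤ} (o : MulAction.orbitRel.Quotient Γ (DualTorus ρ)) : ℕ :=
  Nat.card o.orbit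

/-- The parameters: an orbit `[ξ]` of order `ℓ ∣ n` and the class of an irreducible
`U(n/ℓ)`-representation of the isotropy group of `ξ`, where `ξ = r [ξ]` is a chosen
representative of the orbit. -/
def Params (ρ : Γ →* GL (Fin d) ℤ) (n : ℕ)
    (r : MulAction.orbitRel.Quotient Γ (DualTorus ρ) → DualTorus ρ) :=
  Σ o : {o : MulAction.orbitRel.Quotient Γ (DualTorus ρ) // orbitOrder o ∣ n},
    RepVar (Isotropy (r o.1)) (n / orbitOrder o.1)

/-- The characters of `Λ` occurring in a representation of the crossed product. -/
def fiberCharacters {ρ : Γ →* GL (Fin d) ℤ} {n : ℕ} (τ : Crossed ρ →* U n) :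
    Set (DualTorus ρ) :=
  {χ | ∃ v : Fin n → ℂ, v ≠ 0 ∧
    ∀ a : Lattice d, toRep τ (SemidirectProduct.inl a) v = (χ.char a : ℂ) • v}

/-! ### The torus bundle, its dual, and the universal coverings

`X` is the universal covering of the base, `Γ` its group of deck transformations. -/

/-- The base `B = X / Γ`. -/
abbrev Base (Γ : Type v) [Group Γ] (X : Type u) [MulAction Γ X] : Type u :=
  MulAction.orbitRel.Quotient Γ X

/-- The covering `X → B`. -/
def baseProj (Γ : Type v) [Group Γ] (X : Type u) [MulAction Γ X] (x : X) : Base Γ X :=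
  Quotient.mk (MulAction.orbitRel Γ X) x

/-- The torus `T = (ℝ/ℤ)ᵈ`; the parameter `ρ` only records the action of `Γ`. -/
def Torus (_ρ : Γ →* GL (Fin d) ℤ) : Type := Fin d → UnitAddCircle

instance (ρ : Γ →* GL (Fin d) ℤ) : TopologicalSpace (Torus ρ) :=
  inferInstanceAs (TopologicalSpace (Fin d → UnitAddCircle))

/-- The action of `Γ` on `T` by integral matrices. -/
instance (ρ : Γ →* GL (Fin d) ℤ) : MulAction Γ (Torus ρ) where
  smul γ t := fun i => ∑ j, (ρ γ).1 i j • t j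
  one_smul t := by
    funext i
    change ∑ j, (ρ 1).1 i j • t j = t i
    simp only [map_one, Units.val_one, Matrix.one_apply, ite_smul, one_smul, zero_smul]
    exact (Finset.sum_ite_eq _ _ _).trans (if_pos (Finset.mem_univ i))
  mul_smul γ δ t := by
    funext i
    change ∑ j, (ρ (γ * δ)).1 i j • t j = ∑ j, (ρ γ).1 i j • ∑ l, (ρ δ).1 j l • t l
    simp only [map_mul, Units.val_mul, Matrix.mul_apply, Finset.sum_smul, Finset.smul_sum,
      mul_smul]
    exact Finset.sum_comm

variable (ρ : Γ →* GL (Fin d) ℤ) (X : Type u) [TopologicalSpace X] [MulAction Γ X]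

/-- The torus bundle `M = X ×_ρ T`. -/
abbrev Total : Type u := MulAction.orbitRel.Quotient Γ (X × Torus ρ)

/-- The dual bundle `X ×_{ρ^*} T̂`. -/
abbrev DualTotal : Type u := MulAction.orbitRel.Quotient Γ (X × DualTorus ρ)

/-- The point `[x, ζ]` of the dual bundle. -/
def dualProj (w : X × DualTorus ρ) : DualTotal ρ X := Quotient.mk (MulAction.orbitRel Γ _) w

/-- The bundle projection `[x, t] ↦ [x]` of `M`. -/
def totalToBase : Total ρ X → Base Γ X :=
  Quotient.map' Prod.fst fun _ _ ⟨γ, h⟩ => ⟨γ, congrArg Prod.fst h⟩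

/-- The bundle projection `[x, ζ] ↦ [x]` of the dual bundle. -/
def dualToBase : DualTotal ρ X → Base Γ X :=
  Quotient.map' Prod.fst fun _ _ ⟨γ, h⟩ => ⟨γ, congrArg Prod.fst h⟩

/-- The universal covering `X × ℝᵈ` of `M`; the parameter `ρ` only records the group action. -/
def Cover (_ρ : Γ →* GL (Fin d) ℤ) (X : Type u) : Type u := X × (Fin d → ℝ)

instance : TopologicalSpace (Cover ρ X) := inferInstanceAs (TopologicalSpace (X × (Fin d → ℝ)))

/-- The action `(a, γ) (x, y) = (γ x, ρ(γ) y + a)` of the crossed product. -/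
instance : MulAction (Crossed ρ) (Cover ρ X) where
  smul g w := (g.right • w.1,
    ((ρ g.right).1.map (Int.cast : ℤ → ℝ)).mulVec w.2 + fun i => ((g.left.toAdd i : ℤ) : ℝ))
  one_smul w := by
    refine Prod.ext (one_smul Γ w.1) ?_
    change ((ρ 1).1.map (Int.cast : ℤ → ℝ)).mulVec w.2 + _ = w.2
    funext i
    simp
  mul_smul g h w := by
    refine Prod.ext (mul_smul g.right h.right w.1) ?_
    change ((ρ (g.right * h.right)).1.map (Int.cast : ℤ → ℝ)).mulVec w.2 +
        (fun i => (((g.left * latticeAct ρ g.right h.left).toAdd i : ℤ) : ℝ)) =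
      ((ρ g.right).1.map (Int.cast : ℤ → ℝ)).mulVec
        (((ρ h.right).1.map (Int.cast : ℤ → ℝ)).mulVec w.2 + fun i => ((h.left.toAdd i : ℤ) : ℝ)) +
        fun i => ((g.left.toAdd i : ℤ) : ℝ)
    have h1 : ((ρ (g.right * h.right)).1.map (Int.cast : ℤ → ℝ)) =
        ((ρ g.right).1.map (Int.cast : ℤ → ℝ)) * ((ρ h.right).1.map (Int.cast : ℤ → ℝ)) := by
      rw [map_mul, Units.val_mul]
      exact Matrix.map_mul (f := Int.castRingHom ℝ)
    have h2 : (latticeAct ρ g.right h.left).toAdd = (ρ g.right).1.mulVec h.left.toAdd := rfl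
    rw [h1, Matrix.mulVec_add, Matrix.mulVec_mulVec]
    funext i
    simp only [Pi.add_apply, toAdd_mul, h2, Int.cast_add, Matrix.mulVec, dotProduct,
      Matrix.map_apply, Int.cast_sum, Int.cast_mul]
    ring

/-- The covering `X × ℝᵈ → M`, `(x, y) ↦ [x, y mod Λ]`. -/
def coverProj (w : Cover ρ X) : Total ρ X :=
  Quotient.mk (MulAction.orbitRel Γ (X × Torus ρ)) (w.1, fun i => ((w.2 i : ℝ) : UnitAddCircle))

/-- The point `(x, 0)` of the universal covering of `M`, over the zero section. -/
def coverPt (x : X) : Cover ρ X := (x, 0)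

/-- The leaf through `ξ` of the transverse foliation of the dual bundle: the image of `X × {ξ}`. -/
def Leaf {ρ : Γ →* GL (Fin d) ℤ} (ξ : DualTorus ρ) : Set (DualTotal ρ X) :=
  Set.range fun x : X => dualProj ρ X (x, ξ)

/-- The covering `X → Σ_ξ`, `x ↦ [x, ξ]`. -/
def leafProj {ρ : Γ →* GL (Fin d) ℤ} (ξ : DualTorus ρ) (x : X) : Leaf X ξ :=
  ⟨dualProj ρ X (x, ξ), x, rfl⟩

/-- The fibre product `Z_Σ = M ×_B Σ` for the leaf `Σ` through `ξ`. -/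
def LeafProduct {ρ : Γ →* GL (Fin d) ℤ} (ξ : DualTorus ρ) : Type u :=
  {z : Total ρ X × Leaf X ξ // totalToBase ρ X z.1 = dualToBase ρ X z.2.1}

instance {ρ : Γ →* GL (Fin d) ℤ} (ξ : DualTorus ρ) : TopologicalSpace (LeafProduct X ξ) :=
  inferInstanceAs (TopologicalSpace
    {z : Total ρ X × Leaf X ξ // totalToBase ρ X z.1 = dualToBase ρ X z.2.1})

/-- The projection `p_Σ : Z_Σ → M`. -/
def pLeaf {ρ : Γ →* GL (Fin d) ℤ} (ξ : DualTorus ρ) (z : LeafProduct X ξ) : Total ρ X := z.1.1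

/-- The projection `p̂_Σ : Z_Σ → Σ`. -/
def pLeafHat {ρ : Γ →* GL (Fin d) ℤ} (ξ : DualTorus ρ) (z : LeafProduct X ξ) : Leaf X ξ := z.1.2

/-- The covering `X × ℝᵈ → Z_Σ`, `(x, y) ↦ ([x, y mod Λ], [x, ξ])`. -/
def leafProductProj {ρ : Γ →* GL (Fin d) ℤ} (ξ : DualTorus ρ) (w : Cover ρ X) :
    LeafProduct X ξ :=
  ⟨(coverProj ρ X w, leafProj X ξ w.1), rfl⟩

/-! ### Local systems -/

/-- A family of complex vector spaces over `Y` with a notion of flat (parallel) section: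
`FlatAt s y` says that the section `s` is flat on some neighbourhood of `y`. All flat vector bundles
(local systems) below are presented in this form. -/
structure FlatFamily (Y : Type u) [TopologicalSpace Y] where
  fiber : Y → Type u
  [addCommGroup : ∀ y, AddCommGroup (fiber y)]
  [module : ∀ y, Module ℂ (fiber y)]
  FlatAt : (∀ y, fiber y) → Y → Prop

attribute [instance] FlatFamily.addCommGroup FlatFamily.module

namespace FlatFamily

variable {Y Z : Type u} [TopologicalSpace Y] [TopologicalSpace Z]

/-- Isomorphism of local systems: fibrewise linear isomorphisms which identify flat sections. -/
def Iso (E F : FlatFamily Y) : Prop :=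
  ∃ φ : ∀ y, E.fiber y ≃ₗ[ℂ] F.fiber y,
    ∀ (s : ∀ y, E.fiber y) (y : Y), E.FlatAt s y ↔ F.FlatAt (fun y => φ y (s y)) y

/-- The pull-back `f^* E`: flat sections are locally the pull-backs of flat sections. -/
def pull (f : Z → Y) (E : FlatFamily Y) : FlatFamily Z where
  fiber z := E.fiber (f z)
  FlatAt s z := ∃ t : ∀ y, E.fiber y, E.FlatAt t (f z) ∧ ∀ᶠ z' in 𝓝 z, s z' = t (f z')

/-- The tensor product: flat sections are locally sums of tensors of flat sections. -/
def tensor (E F : FlatFamily Y) : FlatFamily Y where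
  fiber y := E.fiber y ⊗[ℂ] F.fiber y
  FlatAt s y := ∃ (m : ℕ) (a : Fin m → ∀ y, E.fiber y) (b : Fin m → ∀ y, F.fiber y),
    (∀ i, E.FlatAt (a i) y) ∧ (∀ i, F.FlatAt (b i) y) ∧
      ∀ᶠ y' in 𝓝 y, s y' = ∑ i, a i y' ⊗ₜ[ℂ] b i y'

/-- The push-down `p_* E` along a finite covering `p : Z → Y`: the fibre at `y` is the direct sum of
the fibres over the points above `y`, and sections over an open set are the sections of `E` over its
preimage. -/
def push (p : Z → Y) (E : FlatFamily Z) : FlatFamily Y where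
  fiber y := ∀ z : {z : Z // p z = y}, E.fiber z.1
  FlatAt s y := ∀ z : Z, p z = y → E.FlatAt (fun z' => s (p z') ⟨z', rfl⟩) z

/-- The flat vector bundle `Ỹ ×_G ℂᵏ` over `Y` associated to a covering `q : Ỹ → Y` with deck
group `G` and to `τ : G → U(k)`: a vector in the fibre at `y` is a function `f : q⁻¹(y) → ℂᵏ` with
`f (g w) = τ(g) f(w)`; flat sections are given by the locally constant functions. -/
def assoc {G : Type*} [Group G] {W : Type u} [TopologicalSpace W] [MulAction G W]
    (q : W → Y) {k : ℕ} (τ : G →* U k) : FlatFamily Y where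
  fiber y :=
    ({ carrier := {f | ∀ (g : G) (w w' : {w : W // q w = y}),
          w'.1 = g • w.1 → f w' = toRep τ g (f w)}
       add_mem' := fun {f f'} hf hf' g w w' h => by simp [hf g w w' h, hf' g w w' h]
       zero_mem' := fun g w w' h => by simp
       smul_mem' := fun c f hf g w w' h => by simp [hf g w w' h] } :
      Submodule ℂ ({w : W // q w = y} → (Fin k → ℂ)))
  FlatAt s y := ∀ w : W, q w = y →
    ∀ᶠ w' in 𝓝 w, (s (q w')).1 ⟨w', rfl⟩ = (s (q w)).1 ⟨w, rfl⟩

end FlatFamily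

/-- The fibre at `(m, m̂)` of the relative Poincaré line bundle over `M ×_B M̂`: functions `f` of
`(x, y, ζ)` with `[x, y mod Λ] = m`, `[x, ζ] = m̂`, which are invariant under `Γ` and satisfy
`f (x, y + a, ζ) = ζ(a) f(x, y, ζ)` for `a ∈ Λ`. -/
def poincareFiber (m : Total ρ X) (m' : DualTotal ρ X) :
    Submodule ℂ ({w : Cover ρ X × DualTorus ρ //
      coverProj ρ X w.1 = m ∧ dualProj ρ X (w.1.1, w.2) = m'} → ℂ) where
  carrier := {f |
    (∀ (γ : Γ) w w', w'.1 = ((SemidirectProduct.inr γ : Crossed ρ) • w.1.1, γ • w.1.2) →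
      f w' = f w) ∧
    (∀ (a : Lattice d) w w', w'.1 = ((SemidirectProduct.inl a : Crossed ρ) • w.1.1, w.1.2) →
      f w' = (w.1.2.char a : ℂ) * f w)}
  add_mem' := fun {f f'} hf hf' =>
    ⟨fun γ w w' h => by simp [hf.1 γ w w' h, hf'.1 γ w w' h],
      fun a w w' h => by simp [hf.2 a w w' h, hf'.2 a w w' h, mul_add]⟩
  zero_mem' := ⟨fun γ w w' h => by simp, fun a w w' h => by simp⟩
  smul_mem' := fun c f hf =>
    ⟨fun γ w w' h => by simp [hf.1 γ w w' h],
      fun a w w' h => by simp [hf.2 a w w' h, mul_left_comm]⟩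

/-- The restriction of the Poincaré line bundle to `Z_Σ`, `Σ` the leaf through `ξ`. It is flat; a
section is flat if its values at `(x, y, ξ)` are locally constant in `(x, y)`. -/
def poincareLeaf {ρ : Γ →* GL (Fin d) ℤ} (ξ : DualTorus ρ) : FlatFamily (LeafProduct X ξ) where
  fiber z := poincareFiber ρ X z.1.1 z.1.2.1
  FlatAt s z := ∀ w : Cover ρ X, leafProductProj X ξ w = z → ∀ᶠ w' in 𝓝 w,
    (s (leafProductProj X ξ w')).1 ⟨(w', ξ), rfl, rfl⟩ =
      (s (leafProductProj X ξ w)).1 ⟨(w, ξ), rfl, rfl⟩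

/-- The inverse Fourier-Mukai transform `p_{Σ,*} (p̂_Σ^* S ⊗ P_Σ)` of a local system `S` on the
leaf `Σ` through `ξ`. -/
def inverseFM {ρ : Γ →* GL (Fin d) ℤ} (ξ : DualTorus ρ) (S : FlatFamily (Leaf X ξ)) :
    FlatFamily (Total ρ X) :=
  ((S.pull (pLeafHat X ξ)).tensor (poincareLeaf X ξ)).push (pLeaf X ξ)

/-- The local system on the leaf through `ξ` defined by `η : Γ_{ρ,ξ} → U(k)`. -/
def leafSystem {ρ : Γ →* GL (Fin d) ℤ} (ξ : DualTorus ρ) {k : ℕ} (η : Isotropy ξ →* U k) :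
    FlatFamily (Leaf X ξ) :=
  FlatFamily.assoc (leafProj X ξ) η

/-- The flat vector bundle on `M` associated to `τ`, a representation of its fundamental group. -/
def flatBundle {ρ : Γ →* GL (Fin d) ℤ} {n : ℕ} (τ : Crossed ρ →* U n) :
    FlatFamily (Total ρ X) :=
  FlatFamily.assoc (coverProj ρ X) τ

end TorusBundle

end

open TorusBundle

noncomputable section

namespace TorusBundle

section Unitary

variable {G : Type*} [Group G] {n k : ℕ}

theorem toRep_apply (τ : G →* U n) (g : G) (v : Fin n → ℂ) :
    toRep τ g v = (τ g).1.mulVec v := rfl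

/-- The squared Hermitian norm on `ℂⁿ`. -/
def normSqC (v : Fin n → ℂ) : ℝ := ∑ i, ‖v i‖ ^ 2

theorem normSqC_eq (v : Fin n → ℂ) : ((normSqC v : ℝ) : ℂ) = star v ⬝ᵥ v := by
  simp [normSqC, dotProduct, Complex.conj_mul']

theorem normSqC_eq_zero {v : Fin n → ℂ} (h : normSqC v = 0) : v = 0 := by
  have := (Finset.sum_eq_zero_iff_of_nonneg (fun i _ => by positivity)).1 h
  funext i
  simpa using this i (Finset.mem_univ i)

theorem normSqC_mulVec (u : U n) (v : Fin n → ℂ) : normSqC (u.1.mulVec v) = normSqC v := by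
  have h : star u.1 * u.1 = 1 := (Matrix.mem_unitaryGroup_iff'.1 u.2)
  have : ((normSqC (u.1.mulVec v) : ℝ) : ℂ) = normSqC v := by
    rw [normSqC_eq, normSqC_eq, Matrix.star_mulVec, Matrix.dotProduct_mulVec,
      Matrix.vecMul_vecMul, ← Matrix.star_eq_conjTranspose, h, Matrix.vecMul_one]
  exact_mod_cast this

theorem normSqC_toRep (τ : G →* U n) (g : G) (v : Fin n → ℂ) :
    normSqC (toRep τ g v) = normSqC v := normSqC_mulVec _ _

theorem star_dotProduct_toRep (τ : G →* U n) (g : G) (v w : Fin n → ℂ) :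
    star (toRep τ g v) ⬝ᵥ toRep τ g w = star v ⬝ᵥ w := by
  have h : star (τ g).1 * (τ g).1 = 1 := (Matrix.mem_unitaryGroup_iff'.1 (τ g).2)
  rw [toRep_apply, toRep_apply, Matrix.star_mulVec, Matrix.dotProduct_mulVec,
      Matrix.vecMul_vecMul, ← Matrix.star_eq_conjTranspose, h, Matrix.vecMul_one]

theorem normSqC_add_of_orthogonal {v w : Fin n → ℂ} (h : star v ⬝ᵥ w = 0) :
    normSqC (v + w) = normSqC v + normSqC w := by
  have h' : star w ⬝ᵥ v = 0 := by
    have := congrArg star h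
    rwa [← Matrix.star_dotProduct_star, star_star, star_zero] at this
  have : ((normSqC (v + w) : ℝ) : ℂ) = normSqC v + normSqC w := by
    rw [normSqC_eq, normSqC_eq, normSqC_eq]
    simp [h, h']
  exact_mod_cast this

theorem normSqC_sum_of_orthogonal {ι : Type*} (s : Finset ι) (v : ι → Fin n → ℂ)
    (h : ∀ i j, i ≠ j → star (v i) ⬝ᵥ v j = 0) :
    normSqC (∑ i ∈ s, v i) = ∑ i ∈ s, normSqC (v i) := by
  classical
  induction s using Finset.induction_on with
  | empty => simp [normSqC]
  | insert i s his ih =>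
    rw [Finset.sum_insert his, Finset.sum_insert his, normSqC_add_of_orthogonal, ih]
    rw [dotProduct_sum]
    exact Finset.sum_eq_zero fun j hj => h i j (by rintro rfl; exact his hj)

theorem exists_unitary_of_normSqC (L : (Fin n → ℂ) →ₗ[ℂ] (Fin n → ℂ))
    (h : ∀ v, normSqC (L v) = normSqC v) : ∃ u : U n, ∀ v, L v = u.1.mulVec v := by
  set A := LinearMap.toMatrix' L with hA
  have hL : ∀ v, L v = A.mulVec v := fun v => by rw [hA, LinearMap.toMatrix'_mulVec]
  refine ⟨⟨A, ?_⟩, hL⟩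
  rw [Matrix.mem_unitaryGroup_iff']
  have key : (star A * A - 1) = 0 := by
    have := (inner_map_self_eq_zero (Matrix.toEuclideanLin (star A * A - 1))).1 ?_
    · exact (Matrix.toEuclideanLin (𝕜 := ℂ)).map_eq_zero_iff.1 this
    intro x
    have h1 := h (WithLp.ofLp x)
    have h2 : ((normSqC (L (WithLp.ofLp x)) : ℝ) : ℂ) = normSqC (WithLp.ofLp x) := by rw [h1]
    rw [normSqC_eq, normSqC_eq, hL, Matrix.star_mulVec, Matrix.dotProduct_mulVec,
      Matrix.vecMul_vecMul, ← Matrix.star_eq_conjTranspose, ← Matrix.dotProduct_mulVec] at h2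
    rw [EuclideanSpace.inner_eq_star_dotProduct, Matrix.ofLp_toLpLin,
      Matrix.toLin'_apply, Matrix.star_mulVec]
    have hH : (star A * A - 1).conjTranspose = star A * A - 1 := by
      simp [Matrix.star_eq_conjTranspose]
    rw [hH, dotProduct_comm, ← Matrix.dotProduct_mulVec, Matrix.sub_mulVec, dotProduct_sub, h2]
    simp
  exact sub_eq_zero.1 key

theorem isIrr_iff (τ : G →* U n) : IsIrr τ ↔ n ≠ 0 ∧
    ∀ W : Submodule ℂ (Fin n → ℂ), (∀ g, ∀ v ∈ W, toRep τ g v ∈ W) → W = ⊥ ∨ W = ⊤ := by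
  constructor
  · intro h
    have h' : IsSimpleOrder (Subrepresentation (toRep τ)) := h
    refine ⟨?_, fun W hW => ?_⟩
    · rintro rfl
      obtain ⟨a, b, hab⟩ := h'.toNontrivial
      apply hab
      ext v
      rw [Subsingleton.elim v 0]
      exact ⟨fun _ => b.toSubmodule.zero_mem, fun _ => a.toSubmodule.zero_mem⟩
    · rcases h'.eq_bot_or_eq_top ⟨W, fun g v hv => hW g v hv⟩ with h1 | h1
      · exact Or.inl (congrArg Subrepresentation.toSubmodule h1)
      · exact Or.inr (congrArg Subrepresentation.toSubmodule h1)
  · rintro ⟨hn, h⟩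
    have : NeZero n := ⟨hn⟩
    have hnt : Nontrivial (Subrepresentation (toRep τ)) :=
      ⟨⊥, ⊤, fun hbt => (bot_ne_top (α := Submodule ℂ (Fin n → ℂ)))
        (congrArg Subrepresentation.toSubmodule hbt)⟩
    exact { eq_bot_or_eq_top := fun W => (h W.toSubmodule (fun g v hv =>
              W.apply_mem_toSubmodule g hv)).imp
                (fun h => Subrepresentation.toSubmodule_injective h)
                (fun h => Subrepresentation.toSubmodule_injective h) }

theorem isIrr_comp_mulEquiv {P : Type*} [Group P] (e : G ≃* P) (τ : P →* U n) :
    IsIrr (τ.comp e.toMonoidHom) ↔ IsIrr τ := by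
  rw [isIrr_iff, isIrr_iff]
  refine and_congr Iff.rfl (forall_congr' fun W => imp_congr ⟨fun h g => ?_, fun h g => h (e g)⟩
    Iff.rfl)
  simpa [toRep_apply] using h (e.symm g)

end Unitary

section Induced

variable {G : Type*} [Group G] {n k : ℕ} (H : Subgroup G)

/-- The right coset `H g`. -/
abbrev rightCosetMk (g : G) : Quotient (QuotientGroup.rightRel H) :=
  Quotient.mk (QuotientGroup.rightRel H) g

/-- The element `h` of `H` such that the chosen representative of `H g` is `h g`. -/
def outFactor (g : G) : H := ⟨(rightCosetMk H g).out * g⁻¹, by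
  have h := Quotient.exact (Quotient.out_eq (rightCosetMk H g))
  simpa using H.inv_mem (QuotientGroup.rightRel_apply.1 h)⟩

theorem out_rightCosetMk (g : G) : (rightCosetMk H g).out = outFactor H g * g := by
  simp [outFactor]

theorem rightCosetMk_eq_iff {g g' : G} : rightCosetMk H g = rightCosetMk H g' ↔ g' * g⁻¹ ∈ H :=
  Quotient.eq''.trans QuotientGroup.rightRel_apply

variable {H} (σ : H →* U k)

theorem coindV_apply_mul (F : Representation.coindV H.subtype (toRep σ)) (h : H) (g : G) :
    F.1 (h * g) = toRep σ h (F.1 g) := F.2 h g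

theorem normSqC_coindV_out (F : Representation.coindV H.subtype (toRep σ)) (g : G) :
    normSqC (F.1 (rightCosetMk H g).out) = normSqC (F.1 g) := by
  rw [out_rightCosetMk, coindV_apply_mul, normSqC_toRep]

theorem coindV_ext {F F' : Representation.coindV H.subtype (toRep σ)}
    (h : ∀ c : Quotient (QuotientGroup.rightRel H), F.1 c.out = F'.1 c.out) : F = F' := by
  apply Subtype.ext
  funext g
  have := h (rightCosetMk H g)
  rw [out_rightCosetMk, coindV_apply_mul, coindV_apply_mul] at this
  have h2 := congrArg (toRep σ (outFactor H g)⁻¹) this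
  simpa using h2

/-- The squared norm on the space of the induced representation. -/
def coindNormSq (F : Representation.coindV H.subtype (toRep σ)) : ℝ :=
  ∑ᶠ c : Quotient (QuotientGroup.rightRel H), normSqC (F.1 c.out)

theorem coindNormSq_eq {ι : Type*} (e : ι ≃ Quotient (QuotientGroup.rightRel H)) (s : ι → G)
    (hs : ∀ i, rightCosetMk H (s i) = e i) (F : Representation.coindV H.subtype (toRep σ)) :
    coindNormSq σ F = ∑ᶠ i, normSqC (F.1 (s i)) := by
  rw [coindNormSq, ← finsum_comp_equiv e]
  refine finsum_congr fun i => ?_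
  rw [← hs, normSqC_coindV_out]

/-- Right translation of right cosets. -/
def rightCosetMul (H : Subgroup G) (g : G) : Equiv.Perm (Quotient (QuotientGroup.rightRel H)) where
  toFun := Quotient.map' (· * g) fun a b h => by
    rw [QuotientGroup.rightRel_apply] at h ⊢; simpa [mul_assoc] using h
  invFun := Quotient.map' (· * g⁻¹) fun a b h => by
    rw [QuotientGroup.rightRel_apply] at h ⊢; simpa [mul_assoc] using h
  left_inv := fun c => by
    induction c using Quotient.inductionOn'
    simp [Quotient.map'_mk'', mul_assoc]
  right_inv := fun c => by
    induction c using Quotient.inductionOn'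
    simp [Quotient.map'_mk'', mul_assoc]

theorem rightCosetMk_mul (g g' : G) : rightCosetMk H (g' * g) =
    rightCosetMul H g (rightCosetMk H g') :=
  rfl

theorem coindNormSq_coind (g : G) (F : Representation.coindV H.subtype (toRep σ)) :
    coindNormSq σ (Representation.coind H.subtype (toRep σ) g F) = coindNormSq σ F := by
  rw [coindNormSq_eq σ (rightCosetMul H g) (fun c => c.out * g) _ F]
  · rfl
  · intro c
    rw [rightCosetMk_mul]
    congr 1
    exact Quotient.out_eq c

theorem isInducedFrom_iff (τ : G →* U n) : IsInducedFrom H σ τ ↔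
    ∃ e : (Fin n → ℂ) ≃ₗ[ℂ] Representation.coindV H.subtype (toRep σ),
      (∀ g v, e (toRep τ g v) = Representation.coind H.subtype (toRep σ) g (e v)) ∧
      ∀ v, normSqC v = coindNormSq σ (e v) := Iff.rfl

/-- A function in the space of the induced representation is determined by its values on
representatives of the right cosets. -/
def coindVEquivFun : Representation.coindV H.subtype (toRep σ) ≃ₗ[ℂ]
    (Quotient (QuotientGroup.rightRel H) → Fin k → ℂ) where
  toFun F c := F.1 c.out
  map_add' _ _ := rfl
  map_smul' _ _ := rfl
  invFun f := ⟨fun g => toRep σ (outFactor H g)⁻¹ (f (rightCosetMk H g)), by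
    intro h g
    have e3 : rightCosetMk H (h * g) = rightCosetMk H g :=
      (rightCosetMk_eq_iff H).2 (by simp)
    have e4 : (outFactor H (h * g))⁻¹ = h * (outFactor H g)⁻¹ := by
      apply Subtype.ext
      simp [outFactor, e3, mul_assoc]
    change toRep σ (outFactor H (h * g))⁻¹ (f (rightCosetMk H (h * g))) = _
    rw [e4, e3, map_mul]
    rfl⟩
  left_inv F := by
    apply Subtype.ext
    funext g
    change toRep σ (outFactor H g)⁻¹ (F.1 (rightCosetMk H g).out) = F.1 g
    rw [out_rightCosetMk, coindV_apply_mul]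
    simp
  right_inv f := by
    funext c
    have e3 : rightCosetMk H c.out = c := Quotient.out_eq c
    have e4 : outFactor H c.out = 1 := by
      apply Subtype.ext
      simp [outFactor, e3]
    change toRep σ (outFactor H c.out)⁻¹ (f (rightCosetMk H c.out)) = f c
    rw [e4, e3]
    simp

theorem coindVEquivFun_apply (F : Representation.coindV H.subtype (toRep σ))
    (c : Quotient (QuotientGroup.rightRel H)) : coindVEquivFun σ F c = F.1 c.out := rfl

instance finite_rightCosets [H.FiniteIndex] : Finite (Quotient (QuotientGroup.rightRel H)) :=
  Finite.of_equiv _ (QuotientGroup.quotientRightRelEquivQuotientLeftRel H).symm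

theorem card_rightCosets : Nat.card (Quotient (QuotientGroup.rightRel H)) = H.index :=
  Nat.card_congr (QuotientGroup.quotientRightRelEquivQuotientLeftRel H)

theorem finrank_coindV [H.FiniteIndex] :
    Module.finrank ℂ (Representation.coindV H.subtype (toRep σ)) = H.index * k := by
  have := Fintype.ofFinite (Quotient (QuotientGroup.rightRel H))
  rw [(coindVEquivFun σ).finrank_eq, Module.finrank_pi_fintype]
  simp [← card_rightCosets]

theorem IsInducedFrom.eq_index_mul [H.FiniteIndex] {σ : H →* U k} {τ : G →* U n}
    (h : IsInducedFrom H σ τ) : n = H.index * k := by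
  obtain ⟨e, -, -⟩ := h
  rw [← finrank_coindV σ, ← e.finrank_eq, Module.finrank_fin_fun]

/-- The induced representation exists as a homomorphism to the unitary group. -/
theorem exists_isInducedFrom [H.FiniteIndex] (hn : n = H.index * k) :
    ∃ τ : G →* U n, IsInducedFrom H σ τ := by
  have := Fintype.ofFinite (Quotient (QuotientGroup.rightRel H))
  have hcard : Fintype.card (Quotient (QuotientGroup.rightRel H) × Fin k) = n := by
    rw [Fintype.card_prod, Fintype.card_fin, hn, ← card_rightCosets, Nat.card_eq_fintype_card]
  let i := Fintype.equivFinOfCardEq hcard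
  let e : (Fin n → ℂ) ≃ₗ[ℂ] Representation.coindV H.subtype (toRep σ) :=
    (LinearEquiv.funCongrLeft ℂ ℂ i).trans
      ((LinearEquiv.curry ℂ ℂ _ _).trans (coindVEquivFun σ).symm)
  have he : ∀ v, normSqC v = coindNormSq σ (e v) := by
    intro v
    rw [coindNormSq, finsum_eq_sum_of_fintype, normSqC, ← i.sum_comp, Fintype.sum_prod_type]
    refine Finset.sum_congr rfl fun c _ => ?_
    have : (e v).1 c.out = fun j => v (i (c, j)) := by
      rw [← coindVEquivFun_apply]
      simp only [e, LinearEquiv.trans_apply, LinearEquiv.apply_symm_apply]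
      rfl
    rw [this]
    rfl
  have hL : ∀ g, ∀ v, normSqC (e.symm (Representation.coind H.subtype (toRep σ) g (e v))) =
      normSqC v := by
    intro g v
    rw [he, he, e.apply_symm_apply, coindNormSq_coind]
  choose u hu using fun g => exists_unitary_of_normSqC
    (e.symm.toLinearMap ∘ₗ (Representation.coind H.subtype (toRep σ) g) ∘ₗ e.toLinearMap) (hL g)
  have hinj : ∀ a b : U n, (∀ v, a.1.mulVec v = b.1.mulVec v) → a = b := by
    intro a b hab
    apply Subtype.ext
    exact Matrix.mulVec_injective (funext hab)
  refine ⟨⟨⟨u, ?_⟩, ?_⟩, e, ?_, he⟩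
  · apply hinj
    intro v
    rw [← hu, map_one]
    simp
  · intro g g'
    apply hinj
    intro v
    have : (u g * u g').1.mulVec v = (u g).1.mulVec ((u g').1.mulVec v) := by simp
    change (u (g * g')).1.mulVec v = _
    rw [this, ← hu, ← hu, ← hu, map_mul]
    simp only [LinearMap.comp_apply, LinearEquiv.coe_coe, LinearEquiv.apply_symm_apply,
      Module.End.mul_apply]
  · intro g v
    rw [toRep_apply]
    change e ((u g).1.mulVec v) = _
    rw [← hu]
    simp

theorem IsInducedFrom.exists_conj {σ : H →* U k} {τ τ' : G →* U n} (h : IsInducedFrom H σ τ)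
    (h' : IsInducedFrom H σ τ') : ∃ u : U n, ∀ g, τ' g = u * τ g * u⁻¹ := by
  rw [isInducedFrom_iff] at h h'
  obtain ⟨e, he, hn⟩ := h
  obtain ⟨e', he', hn'⟩ := h'
  obtain ⟨u, hu⟩ := exists_unitary_of_normSqC (e'.symm.toLinearMap ∘ₗ e.toLinearMap)
    (fun v => by simp [hn', ← hn])
  refine ⟨u, fun g => ?_⟩
  rw [eq_mul_inv_iff_mul_eq]
  apply Subtype.ext
  apply Matrix.mulVec_injective
  funext v
  have e1 : (τ' g * u).1.mulVec v = toRep τ' g (u.1.mulVec v) := by simp [toRep_apply]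
  have e2 : (u * τ g).1.mulVec v = u.1.mulVec (toRep τ g v) := by simp [toRep_apply]
  rw [e1, e2, ← hu, ← hu]
  apply e'.injective
  simp [he, he']

/-- Unitary equivalence in both representations. -/
theorem IsInducedFrom.congr_conj {σ σ' : H →* U k} {τ τ' : G →* U n} (h : IsInducedFrom H σ τ)
    (w : U k) (hw : ∀ g, σ' g = w * σ g * w⁻¹) (u : U n) (hu : ∀ g, τ' g = u * τ g * u⁻¹) :
    IsInducedFrom H σ' τ' := by
  rw [isInducedFrom_iff] at h ⊢
  obtain ⟨e, he, hn⟩ := h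
  have key : ∀ {m : ℕ} {P : Type _} [Group P] {a a' : P →* U m} {x : U m}
      (_ : ∀ g, a' g = x * a g * x⁻¹) (g : P) (v : Fin m → ℂ),
      x.1.mulVec (toRep a g v) = toRep a' g (x.1.mulVec v) := by
    intro m P _ a a' x hx g v
    have : a' g * x = x * a g := by rw [hx]; group
    have h2 := congrArg (fun y : U m => y.1.mulVec v) this
    simpa [toRep_apply] using h2.symm
  have hinv : ∀ g, τ g = u⁻¹ * τ' g * u⁻¹⁻¹ := fun g => by rw [hu]; group
  have mul_inv : ∀ {m : ℕ} (x : U m) (v : Fin m → ℂ), x.1.mulVec ((x⁻¹).1.mulVec v) = v := by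
    intro m x v
    have : (x * x⁻¹).1.mulVec v = v := by rw [mul_inv_cancel]; simp
    rw [← this]; simp
  have inv_mul : ∀ {m : ℕ} (x : U m) (v : Fin m → ℂ), (x⁻¹).1.mulVec (x.1.mulVec v) = v := by
    intro m x v
    have : (x⁻¹ * x).1.mulVec v = v := by rw [inv_mul_cancel]; simp
    rw [← this]; simp
  have hinv' : ∀ g, σ g = w⁻¹ * σ' g * w⁻¹⁻¹ := fun g => by rw [hw]; group
  let E : Representation.coindV H.subtype (toRep σ) ≃ₗ[ℂ]
      Representation.coindV H.subtype (toRep σ') :=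
    { toFun := fun F => ⟨fun g => w.1.mulVec (F.1 g), fun h g => by
        change w.1.mulVec (F.1 (h * g)) = _
        rw [coindV_apply_mul, key hw]⟩
      invFun := fun F => ⟨fun g => (w⁻¹).1.mulVec (F.1 g), fun h g => by
        change (w⁻¹).1.mulVec (F.1 (h * g)) = _
        rw [coindV_apply_mul, key hinv']⟩
      map_add' := fun F F' => Subtype.ext (funext fun g => Matrix.mulVec_add w.1 (F.1 g) (F'.1 g))
      map_smul' := fun c F => Subtype.ext (funext fun g => Matrix.mulVec_smul w.1 c (F.1 g))
      left_inv := fun F => Subtype.ext (funext fun g => inv_mul _ _)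
      right_inv := fun F => Subtype.ext (funext fun g => mul_inv _ _) }
  let D : (Fin n → ℂ) ≃ₗ[ℂ] (Fin n → ℂ) :=
    { toFun := (u⁻¹).1.mulVec
      invFun := u.1.mulVec
      map_add' := fun F F' => Matrix.mulVec_add _ _ _
      map_smul' := fun c F => Matrix.mulVec_smul _ _ _
      left_inv := fun F => mul_inv _ _
      right_inv := fun F => inv_mul _ _ }
  refine ⟨D.trans (e.trans E), fun g v => ?_, fun v => ?_⟩
  · have : D (toRep τ' g v) = toRep τ g (D v) := key hinv g v
    simp only [LinearEquiv.trans_apply, this, he]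
    rfl
  · have h1 : normSqC (D v) = normSqC v := normSqC_mulVec _ _
    rw [← h1, hn]
    exact finsum_congr fun c => (normSqC_mulVec w _).symm

/-- Inducing from a conjugate subgroup. -/
theorem IsInducedFrom.of_conj {H' : Subgroup G} (g₀ : G)
    (hH : ∀ h, h ∈ H ↔ g₀ * h * g₀⁻¹ ∈ H') {σ : H →* U k} {σ' : H' →* U k}
    (hσ : ∀ h : H, σ' ⟨g₀ * h * g₀⁻¹, (hH h).1 h.2⟩ = σ h)
    {τ : G →* U n} (h : IsInducedFrom H σ τ) : IsInducedFrom H' σ' τ := by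
  rw [isInducedFrom_iff] at h ⊢
  obtain ⟨e, he, hn⟩ := h
  have hrep : ∀ (h : H) (h' : H'), (h' : G) = g₀ * h * g₀⁻¹ → toRep σ' h' = toRep σ h := by
    intro h h' hh
    have : h' = ⟨g₀ * h * g₀⁻¹, (hH h).1 h.2⟩ := Subtype.ext hh
    rw [this]
    ext1 v
    simp only [toRep, MonoidHom.comp_apply, hσ]
  let E : Representation.coindV H.subtype (toRep σ) ≃ₗ[ℂ]
      Representation.coindV H'.subtype (toRep σ') :=
    { toFun := fun F => ⟨fun g => F.1 (g₀⁻¹ * g), fun h' g => by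
        have hmem : g₀⁻¹ * h' * g₀ ∈ H := (hH _).2 (by simp [mul_assoc])
        have := coindV_apply_mul σ F ⟨_, hmem⟩ (g₀⁻¹ * g)
        rw [← hrep ⟨_, hmem⟩ h' (by simp [mul_assoc])] at this
        simpa [mul_assoc] using this⟩
      invFun := fun F => ⟨fun g => F.1 (g₀ * g), fun h g => by
        have := coindV_apply_mul σ' F ⟨_, (hH h).1 h.2⟩ (g₀ * g)
        rw [hrep h _ rfl] at this
        simpa [mul_assoc] using this⟩
      map_add' := fun F F' => rfl
      map_smul' := fun c F => rfl
      left_inv := fun F => Subtype.ext (funext fun g => by simp)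
      right_inv := fun F => Subtype.ext (funext fun g => by simp) }
  let D : Quotient (QuotientGroup.rightRel H) ≃ Quotient (QuotientGroup.rightRel H') :=
    { toFun := Quotient.map' (g₀ * ·) fun a b h => by
        rw [QuotientGroup.rightRel_apply] at h ⊢
        have := (hH _).1 h
        simpa [mul_assoc] using this
      invFun := Quotient.map' (g₀⁻¹ * ·) fun a b h => by
        rw [QuotientGroup.rightRel_apply] at h ⊢
        rw [hH]
        simpa [mul_assoc] using h
      left_inv := fun c => by
        induction c using Quotient.inductionOn'
        simp [Quotient.map'_mk'']
      right_inv := fun c => by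
        induction c using Quotient.inductionOn'
        simp [Quotient.map'_mk''] }
  refine ⟨e.trans E, fun g v => ?_, fun v => ?_⟩
  · simp only [LinearEquiv.trans_apply, he]
    apply Subtype.ext
    funext g'
    change (e v).1 (g₀⁻¹ * g' * g) = (e v).1 (g₀⁻¹ * (g' * g))
    rw [mul_assoc]
  · rw [hn, coindNormSq_eq σ' D (fun c => g₀ * c.out)]
    · refine finsum_congr fun c => ?_
      change _ = normSqC ((e v).1 (g₀⁻¹ * (g₀ * c.out)))
      rw [inv_mul_cancel_left]
    · intro c
      have : D (rightCosetMk H c.out) = D c := congrArg D (Quotient.out_eq c)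
      exact this

end Induced

section Single

variable {G : Type*} [Group G] {k : ℕ} {H : Subgroup G} (σ : H →* U k)

open Classical in
/-- The element of the induced representation supported on `H` with value `v` at `1`. -/
def coindSingle : (Fin k → ℂ) →ₗ[ℂ] Representation.coindV H.subtype (toRep σ) where
  toFun v := ⟨fun g => if h : g ∈ H then toRep σ ⟨g, h⟩ v else 0, by
    intro h g
    by_cases hg : g ∈ H
    · have hm : (h : G) * g ∈ H := H.mul_mem h.2 hg
      have : (⟨h * g, hm⟩ : H) = h * ⟨g, hg⟩ := rfl
      change (if h' : (h : G) * g ∈ H then toRep σ ⟨h * g, h'⟩ v else 0) =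
        toRep σ h (if h' : g ∈ H then toRep σ ⟨g, h'⟩ v else 0)
      rw [dif_pos hm, dif_pos hg, this, map_mul, Module.End.mul_apply]
    · have hm : ¬ (h : G) * g ∈ H := fun hm => hg (by simpa using H.mul_mem (H.inv_mem h.2) hm)
      change (if h' : (h : G) * g ∈ H then toRep σ ⟨h * g, h'⟩ v else 0) =
        toRep σ h (if h' : g ∈ H then toRep σ ⟨g, h'⟩ v else 0)
      rw [dif_neg hm, dif_neg hg, map_zero]⟩
  map_add' v w := by
    apply Subtype.ext
    funext g
    by_cases hg : g ∈ H <;> simp [hg]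
  map_smul' c v := by
    apply Subtype.ext
    funext g
    by_cases hg : g ∈ H <;> simp [hg]

theorem coindSingle_apply_mem (v : Fin k → ℂ) (h : H) :
    (coindSingle σ v).1 h = toRep σ h v := dif_pos h.2

theorem coindSingle_apply_one (v : Fin k → ℂ) : (coindSingle σ v).1 1 = v := by
  have := coindSingle_apply_mem σ v 1
  simpa using this

theorem coindSingle_apply_notMem (v : Fin k → ℂ) {g : G} (h : g ∉ H) :
    (coindSingle σ v).1 g = 0 := dif_neg h

theorem eq_coindSingle {F : Representation.coindV H.subtype (toRep σ)}
    (hF : ∀ g, g ∉ H → F.1 g = 0) : F = coindSingle σ (F.1 1) := by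
  apply Subtype.ext
  funext g
  by_cases hg : g ∈ H
  · have h1 := coindSingle_apply_mem σ (F.1 1) ⟨g, hg⟩
    have h2 := coindV_apply_mul σ F ⟨g, hg⟩ 1
    rw [mul_one] at h2
    rw [h1, h2]
  · rw [hF g hg, coindSingle_apply_notMem σ _ hg]

theorem coind_coindSingle (h : H) (v : Fin k → ℂ) :
    Representation.coind H.subtype (toRep σ) h (coindSingle σ v) =
      coindSingle σ (toRep σ h v) := by
  have hc : ∀ g, (Representation.coind H.subtype (toRep σ) h (coindSingle σ v)).1 g =
      (coindSingle σ v).1 (g * h) := fun g => rfl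
  rw [eq_coindSingle σ (F := Representation.coind H.subtype (toRep σ) h (coindSingle σ v)), hc,
    one_mul, coindSingle_apply_mem]
  intro g hg
  rw [hc]
  exact coindSingle_apply_notMem σ _ fun hm => hg (by simpa using H.mul_mem hm (H.inv_mem h.2))

theorem coindNormSq_coindSingle (v : Fin k → ℂ) :
    coindNormSq σ (coindSingle σ v) = normSqC v := by
  rw [coindNormSq, finsum_eq_single _ (rightCosetMk H 1)]
  · rw [normSqC_coindV_out, coindSingle_apply_one]
  · intro c hc
    rw [coindSingle_apply_notMem]
    · simp [normSqC]
    · intro hm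
      apply hc
      rw [← (show rightCosetMk H c.out = c from Quotient.out_eq c), rightCosetMk_eq_iff]
      simpa using hm

end Single

section Mackey

variable {Γ : Type*} [Group Γ] {d : ℕ} {ρ : Γ →* GL (Fin d) ℤ} {n k : ℕ}

theorem DualTorus.ext_char {ξ ζ : DualTorus ρ} (h : ∀ a, ξ.char a = ζ.char a) : ξ = ζ :=
  MonoidHom.ext h

theorem char_smul (γ : Γ) (ξ : DualTorus ρ) (a : Lattice d) :
    (γ • ξ).char a = ξ.char (latticeAct ρ γ⁻¹ a) := rfl

theorem mul_inl (g : Crossed ρ) (a : Lattice d) :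
    g * SemidirectProduct.inl a = SemidirectProduct.inl (latticeAct ρ g.right a) * g := by
  apply SemidirectProduct.ext
  · simp [mul_comm]
  · simp

theorem mem_crossedIsotropy {ξ : DualTorus ρ} {g : Crossed ρ} :
    g ∈ crossedIsotropy ξ ↔ g.right • ξ = ξ := Iff.rfl

theorem index_isotropy (ξ : DualTorus ρ) :
    (Isotropy ξ).index = Nat.card (MulAction.orbit Γ ξ) := by
  rw [MulAction.index_stabilizer]; rfl

theorem index_crossedIsotropy (ξ : DualTorus ρ) :
    (crossedIsotropy ξ).index = Nat.card (MulAction.orbit Γ ξ) := by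
  rw [crossedIsotropy, Subgroup.index_comap_of_surjective _ SemidirectProduct.rightHom_surjective,
    index_isotropy]

theorem finiteIndex_crossedIsotropy {ξ : DualTorus ρ} (hfin : (MulAction.orbit Γ ξ).Finite) :
    (crossedIsotropy ξ).FiniteIndex := by
  constructor
  rw [index_crossedIsotropy]
  have := hfin.to_subtype
  have : Nonempty (MulAction.orbit Γ ξ) := ⟨⟨ξ, MulAction.mem_orbit_self ξ⟩⟩
  exact Nat.card_pos.ne'

theorem toRep_expRep (ξ : DualTorus ρ) (η : Isotropy ξ →* U k) (g : crossedIsotropy ξ)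
    (v : Fin k → ℂ) :
    toRep (expRep ξ η) g v = (ξ.char g.1.left : ℂ) • toRep η ⟨g.1.right, g.2⟩ v := by
  have : (expRep ξ η g).1 = Matrix.scalar (Fin k) (ξ.char g.1.left : ℂ) *
    (η ⟨g.1.right, g.2⟩).1 := rfl
  rw [toRep_apply, this, ← Matrix.mulVec_mulVec, toRep_apply]
  simp [← Matrix.smul_one_eq_diagonal, Matrix.smul_mulVec]

theorem inl_mem_crossedIsotropy (ξ : DualTorus ρ) (a : Lattice d) :
    SemidirectProduct.inl a ∈ crossedIsotropy ξ := by
  rw [mem_crossedIsotropy]; simp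

theorem toRep_expRep_inl (ξ : DualTorus ρ) (η : Isotropy ξ →* U k) (a : Lattice d)
    (v : Fin k → ℂ) :
    toRep (expRep ξ η) ⟨SemidirectProduct.inl a, inl_mem_crossedIsotropy ξ a⟩ v =
      (ξ.char a : ℂ) • v := by
  refine (toRep_expRep ξ η _ v).trans ?_
  have h1 : toRep η 1 v = v := by simp
  exact congrArg ((ξ.char a : ℂ) • ·) h1

theorem toRep_expRep_inr (ξ : DualTorus ρ) (η : Isotropy ξ →* U k) (γ : Isotropy ξ)
    (v : Fin k → ℂ) :
    toRep (expRep ξ η) ⟨SemidirectProduct.inr γ.1, γ.2⟩ v = toRep η γ v := by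
  refine (toRep_expRep ξ η _ v).trans ?_
  simp

theorem coindV_apply_mul_inl (ξ : DualTorus ρ) (η : Isotropy ξ →* U k)
    (F : Representation.coindV (crossedIsotropy ξ).subtype (toRep (expRep ξ η))) (g : Crossed ρ)
    (a : Lattice d) :
    F.1 (g * SemidirectProduct.inl a) = ((g.right⁻¹ • ξ).char a : ℂ) • F.1 g := by
  have h := coindV_apply_mul _ F ⟨_, inl_mem_crossedIsotropy ξ (latticeAct ρ g.right a)⟩ g
  rw [toRep_expRep_inl] at h
  rw [mul_inl, char_smul, inv_inv]
  exact h

/-- The isotypic component of the character `χ` of the lattice. -/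
def charSpace (τ : Crossed ρ →* U n) (χ : DualTorus ρ) : Submodule ℂ (Fin n → ℂ) where
  carrier := {v | ∀ a : Lattice d, toRep τ (SemidirectProduct.inl a) v = (χ.char a : ℂ) • v}
  add_mem' hv hw a := by rw [map_add, hv a, hw a, smul_add]
  zero_mem' a := by simp
  smul_mem' c v hv a := by rw [map_smul, hv a, smul_comm]

theorem mem_fiberCharacters {τ : Crossed ρ →* U n} {χ : DualTorus ρ} :
    χ ∈ fiberCharacters τ ↔ ∃ v ≠ 0, v ∈ charSpace τ χ := Iff.rfl

theorem toRep_mem_charSpace {τ : Crossed ρ →* U n} {χ : DualTorus ρ} {v : Fin n → ℂ}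
    (hv : v ∈ charSpace τ χ) (g : Crossed ρ) : toRep τ g v ∈ charSpace τ (g.right • χ) := by
  intro a
  have h : SemidirectProduct.inl a * g =
      g * SemidirectProduct.inl (latticeAct ρ g.right⁻¹ a) := by
    rw [mul_inl, ← MulAut.mul_apply, ← map_mul]; simp
  rw [← Module.End.mul_apply, ← map_mul, h, map_mul, Module.End.mul_apply, hv, map_smul]
  rfl

theorem orthogonal_of_mem_charSpace {τ : Crossed ρ →* U n} {χ χ' : DualTorus ρ} (h : χ ≠ χ')
    {v w : Fin n → ℂ} (hv : v ∈ charSpace τ χ) (hw : w ∈ charSpace τ χ') : star v ⬝ᵥ w = 0 := by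
  obtain ⟨a, ha⟩ : ∃ a, χ.char a ≠ χ'.char a := by
    by_contra! hc
    exact h (DualTorus.ext_char hc)
  have h1 := star_dotProduct_toRep τ (SemidirectProduct.inl a) v w
  rw [hv a, hw a, star_smul, smul_dotProduct, dotProduct_smul, smul_smul] at h1
  by_contra h0
  have h2 : star (χ.char a : ℂ) * (χ'.char a : ℂ) = 1 := by
    have : (star (χ.char a : ℂ) * (χ'.char a : ℂ)) * (star v ⬝ᵥ w) = 1 * (star v ⬝ᵥ w) := by
      rw [one_mul]; exact h1
    exact mul_right_cancel₀ h0 this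
  apply ha
  have h3 : (χ.char a)⁻¹ * χ'.char a = 1 := by
    apply Circle.ext
    rw [Circle.coe_mul, Circle.coe_inv_eq_conj, Circle.coe_one]
    exact h2
  exact inv_mul_eq_one.1 h3

theorem finite_fiberCharacters (τ : Crossed ρ →* U n) : (fiberCharacters τ).Finite := by
  have hc : ∀ χ : fiberCharacters τ, ∃ v ≠ 0, v ∈ charSpace τ χ.1 := fun χ => χ.2
  choose v hv0 hv using hc
  have hli : LinearIndependent ℂ v := by
    rw [linearIndependent_iff']
    intro s c hs i hi
    have h1 : star (v i) ⬝ᵥ ∑ j ∈ s, c j • v j = 0 := by rw [hs]; simp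
    rw [dotProduct_sum, Finset.sum_eq_single i] at h1
    · rw [dotProduct_smul, ← normSqC_eq, smul_eq_mul, mul_eq_zero] at h1
      rcases h1 with h1 | h1
      · exact h1
      · exact absurd (normSqC_eq_zero (by exact_mod_cast h1)) (hv0 i)
    · intro j _ hj
      rw [dotProduct_smul, orthogonal_of_mem_charSpace (fun h => hj (Subtype.ext h.symm)) (hv i)
        (hv j), smul_zero]
    · exact fun h => absurd hi h
  exact Set.finite_coe_iff.1 hli.finite

/-- The isotypic component of `ξ` in the induced representation. -/
theorem IsInd.exists_isometry {ξ : DualTorus ρ} {η : Isotropy ξ →* U k} {τ : Crossed ρ →* U n}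
    (h : IsInd ξ η τ) : ∃ j : (Fin k → ℂ) →ₗ[ℂ] (Fin n → ℂ),
      (∀ v, normSqC (j v) = normSqC v) ∧
      (∀ (γ : Isotropy ξ) v, toRep τ (SemidirectProduct.inr γ.1) (j v) = j (toRep η γ v)) ∧
      LinearMap.range j = charSpace τ ξ := by
  obtain ⟨e, he, hn⟩ := (isInducedFrom_iff _ _).1 h
  have hje : ∀ v, e (e.symm (coindSingle (expRep ξ η) v)) = coindSingle (expRep ξ η) v :=
    fun v => e.apply_symm_apply _
  have hmove : ∀ (g : crossedIsotropy ξ) v, toRep τ g.1 (e.symm (coindSingle (expRep ξ η) v)) =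
      e.symm (coindSingle (expRep ξ η) (toRep (expRep ξ η) g v)) := by
    intro g v
    apply e.injective
    rw [he, hje, hje, coind_coindSingle]
  refine ⟨e.symm.toLinearMap ∘ₗ coindSingle (expRep ξ η), fun v => ?_, fun γ v => ?_, ?_⟩
  · rw [hn, LinearMap.comp_apply, LinearEquiv.coe_coe, hje, coindNormSq_coindSingle]
  · have := hmove ⟨SemidirectProduct.inr γ.1, γ.2⟩ v
    rwa [toRep_expRep_inr] at this
  · ext w
    constructor
    · rintro ⟨v, rfl⟩ a
      have := hmove ⟨_, inl_mem_crossedIsotropy ξ a⟩ v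
      rw [toRep_expRep_inl, map_smul, map_smul] at this
      exact this
    · intro hw
      refine ⟨(e w).1 1, ?_⟩
      apply e.injective
      rw [LinearMap.comp_apply, LinearEquiv.coe_coe, hje]
      symm
      apply eq_coindSingle
      intro g hg
      by_contra h0
      apply hg
      rw [mem_crossedIsotropy]
      have : g.right⁻¹ • ξ = ξ := by
        apply DualTorus.ext_char
        intro a
        have h1 := coindV_apply_mul_inl ξ η (e w) g a
        have h2 : (e w).1 (g * SemidirectProduct.inl a) = (ξ.char a : ℂ) • (e w).1 g := by
          have := congrArg (fun F => F.1 g) (he (SemidirectProduct.inl a) w)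
          rw [hw a, map_smul] at this
          exact this.symm
        rw [h2] at h1
        exact Circle.ext (smul_left_injective ℂ h0 h1).symm
      nth_rewrite 1 [← this]
      simp

theorem IsInd.fiberCharacters_eq {ξ : DualTorus ρ} {η : Isotropy ξ →* U k} {τ : Crossed ρ →* U n}
    (h : IsInd ξ η τ) (hk : k ≠ 0) : fiberCharacters τ = MulAction.orbit Γ ξ := by
  obtain ⟨j, hj, -, hr⟩ := h.exists_isometry
  obtain ⟨e, he, hn⟩ := (isInducedFrom_iff _ _).1 h
  ext χ
  rw [mem_fiberCharacters]
  constructor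
  · rintro ⟨w, hw0, hw⟩
    obtain ⟨g, hg⟩ : ∃ g, (e w).1 g ≠ 0 := by
      by_contra! hc
      apply hw0
      apply e.injective
      rw [map_zero]
      exact Subtype.ext (funext hc)
    refine ⟨g.right⁻¹, ?_⟩
    apply DualTorus.ext_char
    intro a
    have h1 := coindV_apply_mul_inl ξ η (e w) g a
    have h2 : (e w).1 (g * SemidirectProduct.inl a) = (χ.char a : ℂ) • (e w).1 g := by
      have := congrArg (fun F => F.1 g) (he (SemidirectProduct.inl a) w)
      rw [hw a, map_smul] at this
      exact this.symm
    rw [h2] at h1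
    exact Circle.ext (smul_left_injective ℂ hg h1).symm
  · rintro ⟨γ, rfl⟩
    have : NeZero k := ⟨hk⟩
    obtain ⟨v, hv⟩ := exists_ne (0 : Fin k → ℂ)
    have hj0 : j v ≠ 0 := fun h0 => hv (normSqC_eq_zero (by rw [← hj, h0]; simp [normSqC]))
    have hjm : j v ∈ charSpace τ ξ := hr ▸ ⟨v, rfl⟩
    refine ⟨toRep τ (SemidirectProduct.inr γ) (j v), fun h0 => hj0 (normSqC_eq_zero ?_), ?_⟩
    · rw [← normSqC_toRep τ (SemidirectProduct.inr γ), h0]; simp [normSqC]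
    · exact toRep_mem_charSpace hjm (SemidirectProduct.inr γ)

theorem IsInd.exists_conj_of_isInd {ξ : DualTorus ρ} {η η' : Isotropy ξ →* U k}
    {τ : Crossed ρ →* U n} (h : IsInd ξ η τ) (h' : IsInd ξ η' τ) :
    ∃ u : U k, ∀ γ, η' γ = u * η γ * u⁻¹ := by
  obtain ⟨j, hj, hη, hr⟩ := h.exists_isometry
  obtain ⟨j', hj', hη', hr'⟩ := h'.exists_isometry
  have hinj : Function.Injective j' := by
    rw [← LinearMap.ker_eq_bot, LinearMap.ker_eq_bot']
    intro v hv
    exact normSqC_eq_zero (by rw [← hj', hv]; simp [normSqC])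
  have hmem : ∀ v, j v ∈ LinearMap.range j' := fun v => by rw [hr', ← hr]; exact ⟨v, rfl⟩
  let L : (Fin k → ℂ) →ₗ[ℂ] (Fin k → ℂ) :=
    (LinearEquiv.ofInjective j' hinj).symm.toLinearMap ∘ₗ j.codRestrict _ hmem
  have hL : ∀ v, j' (L v) = j v := fun v =>
    congrArg Subtype.val ((LinearEquiv.ofInjective j' hinj).apply_symm_apply ⟨j v, hmem v⟩)
  obtain ⟨u, hu⟩ := exists_unitary_of_normSqC L fun v => by rw [← hj', hL, hj]
  refine ⟨u, fun γ => ?_⟩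
  rw [eq_mul_inv_iff_mul_eq]
  apply Subtype.ext
  apply Matrix.mulVec_injective
  funext v
  have e1 : (η' γ * u).1.mulVec v = toRep η' γ (u.1.mulVec v) := by simp [toRep_apply]
  have e2 : (u * η γ).1.mulVec v = u.1.mulVec (toRep η γ v) := by simp [toRep_apply]
  rw [e1, e2, ← hu, ← hu]
  apply hinj
  rw [← hη', hL, hη, hL]

theorem IsInd.isIrr {ξ : DualTorus ρ} {η : Isotropy ξ →* U k} {τ : Crossed ρ →* U n}
    (hfin : (MulAction.orbit Γ ξ).Finite) (hη : IsIrr η) (h : IsInd ξ η τ) : IsIrr τ := by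
  classical
  obtain ⟨e, he, -⟩ := (isInducedFrom_iff _ _).1 h
  obtain ⟨hk, hη⟩ := (isIrr_iff _).1 hη
  have : NeZero k := ⟨hk⟩
  rw [isIrr_iff]
  refine ⟨?_, fun W hW => ?_⟩
  · rintro rfl
    obtain ⟨v, hv⟩ := exists_ne (0 : Fin k → ℂ)
    apply hv
    have h0 : coindSingle (expRep ξ η) v = 0 := by
      apply e.symm.injective
      exact Subsingleton.elim _ _
    rw [← coindSingle_apply_one (expRep ξ η) v, h0]
    rfl
  rw [or_iff_not_imp_left]
  intro hW0
  obtain ⟨w, hw, hw0⟩ := (Submodule.ne_bot_iff W).1 hW0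
  obtain ⟨g, hg⟩ : ∃ g, (e w).1 g ≠ 0 := by
    by_contra! hc
    apply hw0
    apply e.injective
    rw [map_zero]
    exact Subtype.ext (funext hc)
  have hstep : ∀ S : Finset (DualTorus ρ), ξ ∉ S → ∃ w' ∈ W, (e w').1 1 = (e w).1 g ∧
      ∀ g' : Crossed ρ, g'.right⁻¹ • ξ ∈ S → (e w').1 g' = 0 := by
    intro S
    induction S using Finset.induction_on with
    | empty =>
      intro _
      refine ⟨toRep τ g w, hW g w hw, ?_, fun g' h' => absurd h' (by simp)⟩
      rw [he]
      change (e w).1 (1 * g) = _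
      rw [one_mul]
    | insert χ S hχ ih =>
      intro hξ
      rw [Finset.mem_insert, not_or] at hξ
      obtain ⟨w', hw', h1, h2⟩ := ih hξ.2
      obtain ⟨a, ha⟩ : ∃ a, ξ.char a ≠ χ.char a := by
        by_contra! hc
        exact hξ.1 (DualTorus.ext_char hc)
      have ha' : (ξ.char a : ℂ) - χ.char a ≠ 0 := sub_ne_zero.2 fun h => ha (Circle.ext h)
      have hval : ∀ g' : Crossed ρ, (e (toRep τ (SemidirectProduct.inl a) w')).1 g' =
          ((g'.right⁻¹ • ξ).char a : ℂ) • (e w').1 g' := by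
        intro g'
        rw [he]
        exact coindV_apply_mul_inl ξ η (e w') g' a
      have hval' : ∀ g' : Crossed ρ, (e (((ξ.char a : ℂ) - χ.char a)⁻¹ •
          (toRep τ (SemidirectProduct.inl a) w' - (χ.char a : ℂ) • w'))).1 g' =
          (((ξ.char a : ℂ) - χ.char a)⁻¹ * (((g'.right⁻¹ • ξ).char a : ℂ) - χ.char a)) •
            (e w').1 g' := by
        intro g'
        rw [map_smul, map_sub, map_smul]
        change ((ξ.char a : ℂ) - χ.char a)⁻¹ • ((e (toRep τ (SemidirectProduct.inl a) w')).1 g' -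
          (χ.char a : ℂ) • (e w').1 g') = _
        rw [hval, ← sub_smul, smul_smul]
      refine ⟨_, W.smul_mem ((ξ.char a : ℂ) - χ.char a)⁻¹
        (W.sub_mem (hW (SemidirectProduct.inl a) w' hw') (W.smul_mem (χ.char a : ℂ) hw')), ?_, ?_⟩
      · rw [hval']
        simp [inv_mul_cancel₀ ha', h1]
      · intro g' hg'
        rw [hval']
        rcases Finset.mem_insert.1 hg' with h' | h'
        · rw [h', sub_self, mul_zero, zero_smul]
        · rw [h2 g' h', smul_zero]
  obtain ⟨w', hw', h1, h2⟩ := hstep (hfin.toFinset.erase ξ) (by simp)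
  have hsing : e w' = coindSingle (expRep ξ η) ((e w).1 g) := by
    rw [← h1]
    apply eq_coindSingle
    intro g' hg'
    apply h2
    rw [Finset.mem_erase, Set.Finite.mem_toFinset]
    refine ⟨fun hc => hg' ?_, ⟨_, rfl⟩⟩
    rw [mem_crossedIsotropy]
    nth_rewrite 1 [← hc]
    simp
  let W' : Submodule ℂ (Fin k → ℂ) :=
    W.comap (e.symm.toLinearMap ∘ₗ coindSingle (expRep ξ η))
  have hmemW' : ∀ v, v ∈ W' ↔ e.symm (coindSingle (expRep ξ η) v) ∈ W := fun v => Iff.rfl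
  have hW' : W' = ⊤ := by
    refine (hη W' fun γ v hv => ?_).resolve_left fun hbot => ?_
    · have h3 := coind_coindSingle (expRep ξ η) ⟨SemidirectProduct.inr γ.1, γ.2⟩ v
      have h4 := hW (SemidirectProduct.inr γ.1) _ ((hmemW' v).1 hv)
      rw [toRep_expRep_inr] at h3
      rw [hmemW']
      convert h4
      apply e.injective
      rw [he, e.apply_symm_apply, e.apply_symm_apply, h3]
    · have : (e w).1 g ∈ W' := by
        rw [hmemW', ← hsing, e.symm_apply_apply]
        exact hw'
      rw [hbot] at this
      exact hg ((Submodule.mem_bot ℂ).1 this)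
  have hfi := finiteIndex_crossedIsotropy hfin
  have := Fintype.ofFinite (Quotient (QuotientGroup.rightRel (crossedIsotropy ξ)))
  rw [eq_top_iff]
  intro v _
  have hsum : e v = ∑ c : Quotient (QuotientGroup.rightRel (crossedIsotropy ξ)),
      Representation.coind (crossedIsotropy ξ).subtype (toRep (expRep ξ η)) c.out⁻¹
        (coindSingle (expRep ξ η) ((e v).1 c.out)) := by
    apply coindV_ext
    intro c
    have : (∑ c' : Quotient (QuotientGroup.rightRel (crossedIsotropy ξ)),
      Representation.coind (crossedIsotropy ξ).subtype (toRep (expRep ξ η)) c'.out⁻¹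
        (coindSingle (expRep ξ η) ((e v).1 c'.out))).1 c.out =
      ∑ c' : Quotient (QuotientGroup.rightRel (crossedIsotropy ξ)),
        (coindSingle (expRep ξ η) ((e v).1 c'.out)).1 (c.out * c'.out⁻¹) := by
      rw [← Submodule.coe_subtype, map_sum, Finset.sum_apply]
      rfl
    rw [this, Finset.sum_eq_single c]
    · rw [mul_inv_cancel, coindSingle_apply_one]
    · intro c' _ hc'
      apply coindSingle_apply_notMem
      intro hm
      apply hc'
      rw [← Quotient.out_eq c', ← Quotient.out_eq c]
      exact (rightCosetMk_eq_iff _).2 hm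
    · simp
  have hv : v = ∑ c : Quotient (QuotientGroup.rightRel (crossedIsotropy ξ)),
      toRep τ c.out⁻¹ (e.symm (coindSingle (expRep ξ η) ((e v).1 c.out))) := by
    apply e.injective
    rw [map_sum]
    refine hsum.trans (Finset.sum_congr rfl fun c _ => ?_)
    rw [he, e.apply_symm_apply]
  rw [hv]
  refine W.sum_mem fun c _ => hW _ _ ?_
  rw [← hmemW', hW']
  trivial

end Mackey

/-- Every subspace of `ℂⁿ` is the image of an isometry. -/
theorem exists_isometry_range_eq {n : ℕ} (V : Submodule ℂ (Fin n → ℂ)) :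
    ∃ (k : ℕ) (j : (Fin k → ℂ) →ₗ[ℂ] (Fin n → ℂ)),
      (∀ v, normSqC (j v) = normSqC v) ∧ LinearMap.range j = V := by
  let E := WithLp.linearEquiv 2 ℂ (Fin n → ℂ)
  let V' : Submodule ℂ (EuclideanSpace ℂ (Fin n)) := V.comap E.toLinearMap
  let b := stdOrthonormalBasis ℂ V'
  let E' := WithLp.linearEquiv 2 ℂ (Fin (Module.finrank ℂ V') → ℂ)
  refine ⟨Module.finrank ℂ V', E.toLinearMap ∘ₗ V'.subtype ∘ₗ b.repr.symm.toLinearEquiv.toLinearMap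
    ∘ₗ E'.symm.toLinearMap, fun v => ?_, ?_⟩
  · have h1 : ∀ {m : ℕ} (x : EuclideanSpace ℂ (Fin m)), normSqC (WithLp.ofLp x) = ‖x‖ ^ 2 :=
      fun x => (EuclideanSpace.norm_sq_eq x).symm
    have h2 : ‖(b.repr.symm (E'.symm v) : EuclideanSpace ℂ (Fin n))‖ = ‖E'.symm v‖ :=
      b.repr.symm.norm_map (E'.symm v)
    refine (h1 (b.repr.symm (E'.symm v) : EuclideanSpace ℂ (Fin n))).trans ?_
    rw [h2, ← h1]
    rfl
  · ext w
    constructor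
    · rintro ⟨v, rfl⟩
      exact (b.repr.symm (E'.symm v)).2
    · intro hw
      refine ⟨E' (b.repr ⟨E.symm w, hw⟩), ?_⟩
      simp

section Clifford

variable {Γ : Type*} [Group Γ] {d : ℕ} {ρ : Γ →* GL (Fin d) ℤ} {n k : ℕ}

theorem exists_scalar_of_commute {n : ℕ} {A : Type*} [CommGroup A] (π : A →* U n) (hn : n ≠ 0) :
    ∃ v : Fin n → ℂ, v ≠ 0 ∧ ∀ a, ∃ c : ℂ, toRep π a v = c • v := by
  have : NeZero n := ⟨hn⟩
  let p : ℕ → Prop := fun m => ∃ W : Submodule ℂ (Fin n → ℂ), W ≠ ⊥ ∧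
    (∀ a, ∀ v ∈ W, toRep π a v ∈ W) ∧ Module.finrank ℂ W = m
  have hp : ∃ m, p m := ⟨_, ⊤, bot_ne_top.symm, fun a v _ => trivial, rfl⟩
  classical
  obtain ⟨W, hW0, hW, hm⟩ := Nat.find_spec hp
  have hmin : ∀ W' : Submodule ℂ (Fin n → ℂ), W' ≠ ⊥ → (∀ a, ∀ v ∈ W', toRep π a v ∈ W') →
      W' ≤ W → W' = W := by
    intro W' h0 h1 h2
    apply Submodule.eq_of_le_of_finrank_le h2
    rw [hm]
    exact Nat.find_min' hp ⟨W', h0, h1, rfl⟩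
  obtain ⟨v, hv, hv0⟩ := (Submodule.ne_bot_iff W).1 hW0
  refine ⟨v, hv0, fun a => ?_⟩
  have : Nontrivial W := (Submodule.nontrivial_iff_ne_bot).2 hW0
  obtain ⟨c, hc⟩ := Module.End.exists_eigenvalue ((toRep π a).restrict (hW a))
  obtain ⟨w, hw⟩ := hc.exists_hasEigenvector
  refine ⟨c, ?_⟩
  have h1 := hmin (W ⊓ Module.End.eigenspace (toRep π a) c) ?_ ?_ inf_le_left
  · rw [← h1] at hv
    exact Module.End.mem_eigenspace_iff.1 hv.2
  · rw [Submodule.ne_bot_iff]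
    refine ⟨w.1, ⟨w.2, ?_⟩, fun h => hw.2 (Subtype.ext h)⟩
    rw [SetLike.mem_coe, Module.End.mem_eigenspace_iff]
    exact congrArg Subtype.val hw.apply_eq_smul
  · rintro b x ⟨hx1, hx2⟩
    refine ⟨hW b x hx1, ?_⟩
    rw [SetLike.mem_coe, Module.End.mem_eigenspace_iff] at hx2 ⊢
    rw [← Module.End.mul_apply, ← map_mul, mul_comm, map_mul, Module.End.mul_apply, hx2, map_smul]

theorem fiberCharacters_nonempty (τ : Crossed ρ →* U n) (hn : n ≠ 0) :
    (fiberCharacters τ).Nonempty := by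
  obtain ⟨v, hv0, hv⟩ := exists_scalar_of_commute (τ.comp SemidirectProduct.inl) hn
  choose c hc using hv
  have hc' : ∀ a : Lattice d, toRep τ (SemidirectProduct.inl a) v = c a • v := hc
  have hv1 : normSqC v ≠ 0 := fun h => hv0 (normSqC_eq_zero h)
  have hnorm : ∀ a, ‖c a‖ = 1 := by
    intro a
    have h1 := normSqC_toRep τ (SemidirectProduct.inl a) v
    rw [hc'] at h1
    have h2 : normSqC (c a • v) = ‖c a‖ ^ 2 * normSqC v := by
      simp [normSqC, mul_pow, Finset.mul_sum]
    rw [h2] at h1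
    have h3 : ‖c a‖ ^ 2 = 1 := by
      apply mul_right_cancel₀ hv1
      rw [h1, one_mul]
    exact (pow_eq_one_iff_of_nonneg (norm_nonneg _) two_ne_zero).1 h3
  let χ : Lattice d →* Circle :=
    { toFun := fun a => ⟨c a, mem_sphere_zero_iff_norm.2 (hnorm a)⟩
      map_one' := by
        apply Circle.ext
        have := hc' 1
        rw [map_one, map_one, Module.End.one_apply] at this
        apply smul_left_injective ℂ hv0
        change c 1 • v = (1 : ℂ) • v
        rw [one_smul]; exact this.symm
      map_mul' := fun a b => by
        apply Circle.ext
        apply smul_left_injective ℂ hv0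
        change c (a * b) • v = (c a * c b) • v
        rw [← hc', map_mul, map_mul, Module.End.mul_apply, hc', map_smul, hc', smul_smul, mul_comm] }
  exact ⟨χ, v, hv0, hc'⟩

/-- A copy of an irreducible representation of the isotropy group in the isotypic component of `ξ`
exhibits an irreducible representation as induced. -/
theorem isInd_of_isometry {ξ : DualTorus ρ} (hfin : (MulAction.orbit Γ ξ).Finite)
    {η : Isotropy ξ →* U k} {τ : Crossed ρ →* U n} (hτ : IsIrr τ) (hk : k ≠ 0)
    (j : (Fin k → ℂ) →ₗ[ℂ] (Fin n → ℂ)) (hj : ∀ v, normSqC (j v) = normSqC v)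
    (hη : ∀ (γ : Isotropy ξ) v, toRep τ (SemidirectProduct.inr γ.1) (j v) = j (toRep η γ v))
    (hr : ∀ v, j v ∈ charSpace τ ξ) : IsInd ξ η τ := by
  have hfi := finiteIndex_crossedIsotropy hfin
  have := Fintype.ofFinite (Quotient (QuotientGroup.rightRel (crossedIsotropy ξ)))
  have hexp : ∀ (h : crossedIsotropy ξ) v, toRep τ h.1 (j v) = j (toRep (expRep ξ η) h v) := by
    intro h v
    have hd : h.1 = SemidirectProduct.inl h.1.left * SemidirectProduct.inr h.1.right := by simp
    have e1 := hη ⟨h.1.right, h.2⟩ v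
    rw [toRep_expRep, map_smul, ← e1]
    conv_lhs => rw [hd, map_mul, Module.End.mul_apply]
    rw [e1]
    exact hr _ _
  let V := Representation.coindV (crossedIsotropy ξ).subtype (toRep (expRep ξ η))
  let t : Crossed ρ → V →ₗ[ℂ] (Fin n → ℂ) := fun g =>
    toRep τ g⁻¹ ∘ₗ j ∘ₗ LinearMap.proj g ∘ₗ V.subtype
  have ht : ∀ g (F : V), t g F = toRep τ g⁻¹ (j (F.1 g)) := fun g F => rfl
  have htc : ∀ g (F : V), t (rightCosetMk (crossedIsotropy ξ) g).out F = t g F := by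
    intro g F
    rw [out_rightCosetMk, ht, ht, coindV_apply_mul, ← hexp, ← Module.End.mul_apply, ← map_mul,
      mul_inv_rev, inv_mul_cancel_right]
  have htm : ∀ g (F : V), t g F ∈ charSpace τ (g.right⁻¹ • ξ) := fun g F =>
    toRep_mem_charSpace (hr _) g⁻¹
  let Ψ : V →ₗ[ℂ] (Fin n → ℂ) :=
    ∑ c : Quotient (QuotientGroup.rightRel (crossedIsotropy ξ)), t c.out
  have hΨ : ∀ F, Ψ F = ∑ c : Quotient (QuotientGroup.rightRel (crossedIsotropy ξ)), t c.out F :=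
    fun F => LinearMap.sum_apply _ _ _
  have hnorm : ∀ F, normSqC (Ψ F) = coindNormSq (expRep ξ η) F := by
    intro F
    rw [hΨ, normSqC_sum_of_orthogonal, coindNormSq, finsum_eq_sum_of_fintype]
    · refine Finset.sum_congr rfl fun c _ => ?_
      rw [ht, normSqC_toRep, hj]
    · intro c c' hcc
      refine orthogonal_of_mem_charSpace ?_ (htm _ _) (htm _ _)
      intro heq
      apply hcc
      rw [← Quotient.out_eq c, ← Quotient.out_eq c']
      refine (rightCosetMk_eq_iff _).2 ?_
      rw [mem_crossedIsotropy, SemidirectProduct.mul_right, SemidirectProduct.inv_right, mul_smul,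
        heq, smul_inv_smul]
  have hinj : Function.Injective Ψ := by
    rw [← LinearMap.ker_eq_bot, LinearMap.ker_eq_bot']
    intro F hF
    have h0 := hnorm F
    rw [hF, coindNormSq, finsum_eq_sum_of_fintype] at h0
    have h1 : ∑ c : Quotient (QuotientGroup.rightRel (crossedIsotropy ξ)), normSqC (F.1 c.out) = 0 :=
      by rw [← h0]; simp [normSqC]
    have h2 : ∀ v : Fin k → ℂ, 0 ≤ normSqC v := fun v =>
      Finset.sum_nonneg fun i _ => by positivity
    rw [Finset.sum_eq_zero_iff_of_nonneg fun c _ => h2 _] at h1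
    apply coindV_ext
    intro c
    exact normSqC_eq_zero (h1 c (Finset.mem_univ c))
  have hint : ∀ g F, toRep τ g (Ψ F) = Ψ (Representation.coind (crossedIsotropy ξ).subtype
      (toRep (expRep ξ η)) g F) := by
    intro g F
    rw [hΨ, hΨ, map_sum]
    rw [← Equiv.sum_comp (rightCosetMul (crossedIsotropy ξ) g)]
    refine Finset.sum_congr rfl fun c _ => ?_
    have h1 : rightCosetMul (crossedIsotropy ξ) g c =
        rightCosetMk (crossedIsotropy ξ) (c.out * g) := by
      rw [rightCosetMk_mul, show rightCosetMk (crossedIsotropy ξ) c.out = c from Quotient.out_eq c]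
    rw [h1, htc, ht, ht]
    rw [← Module.End.mul_apply, ← map_mul, mul_inv_rev, mul_inv_cancel_left]
    rfl
  have hsurj : LinearMap.range Ψ = ⊤ := by
    refine (((isIrr_iff τ).1 hτ).2 (LinearMap.range Ψ) ?_).resolve_left ?_
    · rintro g _ ⟨F, rfl⟩
      exact ⟨_, (hint g F).symm⟩
    · intro h0
      have : NeZero k := ⟨hk⟩
      obtain ⟨v, hv⟩ := exists_ne (0 : Fin k → ℂ)
      apply hv
      have h1 : Ψ (coindSingle (expRep ξ η) v) = Ψ 0 := by
        rw [LinearMap.range_eq_bot.1 h0]; rfl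
      rw [← coindSingle_apply_one (expRep ξ η) v, hinj h1]
      rfl
  let e := (LinearEquiv.ofBijective Ψ ⟨hinj, LinearMap.range_eq_top.1 hsurj⟩)
  refine (isInducedFrom_iff _ _).2 ⟨e.symm, fun g v => ?_, fun v => ?_⟩
  · rw [LinearEquiv.symm_apply_eq]
    change _ = Ψ _
    rw [← hint]
    congr 1
    exact (e.apply_symm_apply v).symm
  · rw [← hnorm]
    exact congrArg normSqC (e.apply_symm_apply v).symm

theorem IsInd.isIrr_isotropy {ξ : DualTorus ρ} {η : Isotropy ξ →* U k} {τ : Crossed ρ →* U n}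
    (h : IsInd ξ η τ) (hτ : IsIrr τ) (hk : k ≠ 0) : IsIrr η := by
  obtain ⟨e, he, -⟩ := (isInducedFrom_iff _ _).1 h
  rw [isIrr_iff]
  refine ⟨hk, fun W hW => or_iff_not_imp_left.2 fun hW0 => ?_⟩
  have hWe : ∀ (g : crossedIsotropy ξ), ∀ v ∈ W, toRep (expRep ξ η) g v ∈ W := by
    intro g v hv
    rw [toRep_expRep]
    exact W.smul_mem _ (hW _ _ hv)
  have hsing : ∀ v ∈ W, ∀ g, (coindSingle (expRep ξ η) v).1 g ∈ W := by
    intro v hv g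
    by_cases hg : g ∈ crossedIsotropy ξ
    · rw [coindSingle_apply_mem (expRep ξ η) v ⟨g, hg⟩]
      exact hWe _ _ hv
    · rw [coindSingle_apply_notMem _ _ hg]
      exact W.zero_mem
  let W' : Submodule ℂ (Fin n → ℂ) :=
    { carrier := {w | ∀ g, (e w).1 g ∈ W}
      add_mem' := fun {v w} hv hw g => by
        rw [map_add]; exact W.add_mem (hv g) (hw g)
      zero_mem' := fun g => by rw [map_zero]; exact W.zero_mem
      smul_mem' := fun c v hv g => by rw [map_smul]; exact W.smul_mem c (hv g) }
  have hW' : W' = ⊤ := by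
    refine (((isIrr_iff τ).1 hτ).2 W' fun g v hv g' => ?_).resolve_left fun h0 => ?_
    · rw [he]
      exact hv (g' * g)
    · obtain ⟨v, hv, hv0⟩ := (Submodule.ne_bot_iff W).1 hW0
      apply hv0
      have hm : e.symm (coindSingle (expRep ξ η) v) ∈ W' := by
        intro g
        rw [e.apply_symm_apply]
        exact hsing v hv g
      rw [h0, Submodule.mem_bot, LinearEquiv.map_eq_zero_iff] at hm
      rw [← coindSingle_apply_one (expRep ξ η) v, hm]
      rfl
  rw [eq_top_iff]
  intro v _
  have hm : e.symm (coindSingle (expRep ξ η) v) ∈ W' := by rw [hW']; trivial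
  have h1 := hm 1
  rwa [e.apply_symm_apply, coindSingle_apply_one] at h1

theorem smul_mem_fiberCharacters {τ : Crossed ρ →* U n} {ξ : DualTorus ρ}
    (h : ξ ∈ fiberCharacters τ) (γ : Γ) : γ • ξ ∈ fiberCharacters τ := by
  obtain ⟨v, hv0, hv⟩ := mem_fiberCharacters.1 h
  refine mem_fiberCharacters.2 ⟨toRep τ (SemidirectProduct.inr γ) v,
    fun h0 => hv0 (normSqC_eq_zero ?_), toRep_mem_charSpace hv (SemidirectProduct.inr γ)⟩
  rw [← normSqC_toRep τ (SemidirectProduct.inr γ), h0]; simp [normSqC]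

theorem orbit_finite_of_mem_fiberCharacters {τ : Crossed ρ →* U n} {ξ : DualTorus ρ}
    (h : ξ ∈ fiberCharacters τ) : (MulAction.orbit Γ ξ).Finite :=
  (finite_fiberCharacters τ).subset (by rintro _ ⟨γ, rfl⟩; exact smul_mem_fiberCharacters h γ)

theorem exists_isInd {τ : Crossed ρ →* U n} (hτ : IsIrr τ) {ξ : DualTorus ρ}
    (hξ : ξ ∈ fiberCharacters τ) :
    ∃ (k : ℕ) (η : Isotropy ξ →* U k), IsIrr η ∧ IsInd ξ η τ := by
  obtain ⟨k, j, hj, hr⟩ := exists_isometry_range_eq (charSpace τ ξ)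
  have hinj : Function.Injective j := by
    rw [← LinearMap.ker_eq_bot, LinearMap.ker_eq_bot']
    intro v hv
    exact normSqC_eq_zero (by rw [← hj, hv]; simp [normSqC])
  have hmem : ∀ v, j v ∈ charSpace τ ξ := fun v => hr ▸ ⟨v, rfl⟩
  have hmemγ : ∀ (γ : Isotropy ξ) v,
      toRep τ (SemidirectProduct.inr γ.1) (j v) ∈ LinearMap.range j := by
    intro γ v
    rw [hr]
    have h1 := toRep_mem_charSpace (hmem v) (SemidirectProduct.inr γ.1)
    have h2 : (SemidirectProduct.inr γ.1 : Crossed ρ).right • ξ = ξ := γ.2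
    rwa [h2] at h1
  let L : Isotropy ξ → (Fin k → ℂ) →ₗ[ℂ] (Fin k → ℂ) := fun γ =>
    (LinearEquiv.ofInjective j hinj).symm.toLinearMap ∘ₗ
      (toRep τ (SemidirectProduct.inr γ.1) ∘ₗ j).codRestrict _ (hmemγ γ)
  have hL : ∀ γ v, j (L γ v) = toRep τ (SemidirectProduct.inr γ.1) (j v) := fun γ v =>
    congrArg Subtype.val ((LinearEquiv.ofInjective j hinj).apply_symm_apply ⟨_, hmemγ γ v⟩)
  choose u hu using fun γ => exists_unitary_of_normSqC (L γ) fun v => by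
    rw [← hj, hL, normSqC_toRep, hj]
  have hext : ∀ a b : U k, (∀ v, j (a.1.mulVec v) = j (b.1.mulVec v)) → a = b := by
    intro a b hab
    apply Subtype.ext
    exact Matrix.mulVec_injective (funext fun v => hinj (hab v))
  let η : Isotropy ξ →* U k :=
    { toFun := u
      map_one' := by
        apply hext
        intro v
        rw [← hu, hL]
        simp
      map_mul' := fun γ γ' => by
        apply hext
        intro v
        have : (u γ * u γ').1.mulVec v = (u γ).1.mulVec ((u γ').1.mulVec v) := by simp
        rw [this, ← hu, ← hu, ← hu, hL, hL, hL, ← Module.End.mul_apply, ← map_mul, ← map_mul]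
        rfl }
  have hk : k ≠ 0 := by
    rintro rfl
    obtain ⟨v, hv0, hv⟩ := mem_fiberCharacters.1 hξ
    rw [← hr] at hv
    obtain ⟨w, rfl⟩ := hv
    apply hv0
    rw [Subsingleton.elim w 0, map_zero]
  have hind : IsInd ξ η τ := isInd_of_isometry (orbit_finite_of_mem_fiberCharacters hξ) hτ hk j hj
    (fun γ v => by rw [← hL, hu]; rfl) hmem
  exact ⟨k, η, hind.isIrr_isotropy hτ hk, hind⟩

theorem expRep_conj {ξ : DualTorus ρ} {η η' : Isotropy ξ →* U k} {u : U k}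
    (h : ∀ γ, η' γ = u * η γ * u⁻¹) (g : crossedIsotropy ξ) :
    expRep ξ η' g = u * expRep ξ η g * u⁻¹ := by
  change scalarU k (ξ.char g.1.left) * η' _ = u * (scalarU k (ξ.char g.1.left) * η _) * u⁻¹
  have comm : u * scalarU k (ξ.char g.1.left) = scalarU k (ξ.char g.1.left) * u := by
    apply Subtype.ext
    exact ((Matrix.scalar_commute (ξ.char g.1.left : ℂ) (fun _ => Commute.all _ _) u.1).eq).symm
  rw [h, ← mul_assoc u, comm]
  group

theorem IsInd.smul {ξ : DualTorus ρ} {γ : Γ} {η : Isotropy ξ →* U k}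
    {η' : Isotropy (γ • ξ) →* U k} (hη : ∀ (h : Isotropy ξ) (h' : Isotropy (γ • ξ)),
      (h' : Γ) = γ * h * γ⁻¹ → η' h' = η h) {τ : Crossed ρ →* U n} (h : IsInd ξ η τ) :
    IsInd (γ • ξ) η' τ := by
  refine IsInducedFrom.of_conj (SemidirectProduct.inr γ) (fun g => ?_) (fun g => ?_) h
  · rw [mem_crossedIsotropy, mem_crossedIsotropy]
    simp [mul_smul]
  · change scalarU k _ * η' _ = scalarU k _ * η _
    rw [hη ⟨g.1.right, g.2⟩]
    · congr 2
      rw [char_smul]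
      simp
    · simp

theorem isInd_smul_iff {ξ : DualTorus ρ} {γ : Γ} {η : Isotropy ξ →* U k}
    {η' : Isotropy (γ • ξ) →* U k} (hη : ∀ (h : Isotropy ξ) (h' : Isotropy (γ • ξ)),
      (h' : Γ) = γ * h * γ⁻¹ → η' h' = η h) (τ : Crossed ρ →* U n) :
    IsInd ξ η τ ↔ IsInd (γ • ξ) η' τ := by
  refine ⟨IsInd.smul hη, fun h => ?_⟩
  refine IsInducedFrom.of_conj (SemidirectProduct.inr γ)⁻¹ (fun g => ?_) (fun g => ?_) h
  · rw [mem_crossedIsotropy, mem_crossedIsotropy]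
    simp [mul_smul, inv_smul_eq_iff]
  · have hm : γ⁻¹ * g.1.right * γ ∈ Isotropy ξ := by
      have h1 : g.1.right • γ • ξ = γ • ξ := g.2
      rw [MulAction.mem_stabilizer_iff, mul_smul, mul_smul, h1, inv_smul_smul]
    change scalarU k _ * η _ = scalarU k _ * η' _
    rw [hη ⟨_, hm⟩ ⟨g.1.right, g.2⟩ (by simp [mul_assoc])]
    congr 2
    · rw [char_smul]
      simp
    · congr 1
      simp

end Clifford

section Parametrization

variable {Γ : Type*} [Group Γ] {d : ℕ} {ρ : Γ →* GL (Fin d) ℤ} {n : ℕ}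

theorem orbitOrder_eq {o : MulAction.orbitRel.Quotient Γ (DualTorus ρ)} {ξ : DualTorus ρ}
    (h : ξ ∈ o.orbit) : orbitOrder o = Nat.card (MulAction.orbit Γ ξ) := by
  rw [orbitOrder, ← MulAction.orbitRel.Quotient.mem_orbit.1 h]
  rfl

theorem RepVar.mk_eq_mk {G : Type*} [Group G] {τ τ' : G →* U n} {h : IsIrr τ} {h' : IsIrr τ'} :
    RepVar.mk τ h = RepVar.mk τ' h' ↔ ∃ u : U n, ∀ g, τ' g = u * τ g * u⁻¹ :=
  Quotient.eq''

theorem exists_params_equiv (hn : 1 ≤ n)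
    (r : MulAction.orbitRel.Quotient Γ (DualTorus ρ) → DualTorus ρ) (hr : ∀ o, r o ∈ o.orbit)
    {P : Type*} [Group P] (eM : Crossed ρ ≃* P) :
    ∃ Φ : Params ρ n r ≃ RepVar P n,
      ∀ (o : {o : MulAction.orbitRel.Quotient Γ (DualTorus ρ) // orbitOrder o ∣ n})
        (η : Isotropy (r o.1) →* U (n / orbitOrder o.1)) (hη : IsIrr η) (τ : P →* U n),
        IsInd (r o.1) η (τ.comp eM.toMonoidHom) ↔
          ∃ hτ : IsIrr τ, Φ ⟨o, RepVar.mk η hη⟩ = RepVar.mk τ hτ := by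
  have hpos : ∀ o : {o : MulAction.orbitRel.Quotient Γ (DualTorus ρ) // orbitOrder o ∣ n},
      0 < orbitOrder o.1 := fun o => Nat.pos_of_dvd_of_pos o.2 hn
  have hfin : ∀ o : {o : MulAction.orbitRel.Quotient Γ (DualTorus ρ) // orbitOrder o ∣ n},
      (MulAction.orbit Γ (r o.1)).Finite := fun o => by
    have := hpos o
    rw [orbitOrder_eq (hr o.1)] at this
    exact Set.finite_coe_iff.1 (Nat.finite_of_card_ne_zero this.ne')
  have hirr : ∀ (o : {o : MulAction.orbitRel.Quotient Γ (DualTorus ρ) // orbitOrder o ∣ n})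
      {k : ℕ} {η : Isotropy (r o.1) →* U k} (_ : IsIrr η) {τ : P →* U n},
      IsInd (r o.1) η (τ.comp eM.toMonoidHom) → IsIrr τ := fun o k η hη τ h =>
    (isIrr_comp_mulEquiv eM τ).1 (h.isIrr (hfin o) hη)
  have hex : ∀ p : Params ρ n r, ∃ q : RepVar P n,
      ∀ (η : Isotropy (r p.1.1) →* U (n / orbitOrder p.1.1)) (hη : IsIrr η),
        p.2 = RepVar.mk η hη → ∀ τ : P →* U n,
          IsInd (r p.1.1) η (τ.comp eM.toMonoidHom) ↔ ∃ hτ : IsIrr τ, q = RepVar.mk τ hτ := by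
    rintro ⟨o, q₀⟩
    induction q₀ using Quotient.inductionOn' with
    | h a =>
    obtain ⟨η₀, hη₀⟩ := a
    have hidx : (crossedIsotropy (r o.1)).index = orbitOrder o.1 := by
      rw [index_crossedIsotropy, orbitOrder_eq (hr o.1)]
    have hfi : (crossedIsotropy (r o.1)).FiniteIndex := ⟨by rw [hidx]; exact (hpos o).ne'⟩
    obtain ⟨τ₀, hτ₀⟩ := exists_isInducedFrom (n := n) (expRep (r o.1) η₀)
      (by rw [hidx, Nat.mul_div_cancel' o.2])
    have hcomp : (τ₀.comp eM.symm.toMonoidHom).comp eM.toMonoidHom = τ₀ := by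
      ext1 g; simp
    have hτ₀' : IsInd (r o.1) η₀ ((τ₀.comp eM.symm.toMonoidHom).comp eM.toMonoidHom) := by
      rw [hcomp]; exact hτ₀
    refine ⟨RepVar.mk _ (hirr o hη₀ hτ₀'), fun η hη hηη τ => ?_⟩
    obtain ⟨w, hw⟩ := RepVar.mk_eq_mk.1 hηη
    have hτη : IsInd (r o.1) η ((τ₀.comp eM.symm.toMonoidHom).comp eM.toMonoidHom) :=
      IsInducedFrom.congr_conj hτ₀' w (expRep_conj hw) 1 (by simp)
    constructor
    · intro h
      refine ⟨hirr o hη h, RepVar.mk_eq_mk.2 ?_⟩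
      obtain ⟨u, hu⟩ := IsInducedFrom.exists_conj hτη h
      exact ⟨u, fun g => by simpa using hu (eM.symm g)⟩
    · rintro ⟨hτ, heq⟩
      obtain ⟨u, hu⟩ := RepVar.mk_eq_mk.1 heq
      exact IsInducedFrom.congr_conj hτη 1 (by simp) u (fun g => hu (eM g))
  choose f hf using hex
  have hf' : ∀ (o : {o : MulAction.orbitRel.Quotient Γ (DualTorus ρ) // orbitOrder o ∣ n})
      (η : Isotropy (r o.1) →* U (n / orbitOrder o.1)) (hη : IsIrr η) (τ : P →* U n),
      IsInd (r o.1) η (τ.comp eM.toMonoidHom) ↔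
        ∃ hτ : IsIrr τ, f ⟨o, RepVar.mk η hη⟩ = RepVar.mk τ hτ := fun o η hη τ =>
    hf ⟨o, RepVar.mk η hη⟩ η hη rfl τ
  have hbij : Function.Bijective f := by
    constructor
    · rintro ⟨o, q⟩ ⟨o', q'⟩ heq
      induction q using Quotient.inductionOn' with
      | h a =>
      induction q' using Quotient.inductionOn' with
      | h a' =>
      obtain ⟨η, hη⟩ := a
      obtain ⟨η', hη'⟩ := a'
      obtain ⟨⟨τ, hτ⟩, hmk⟩ := Quotient.exists_rep (f ⟨o', RepVar.mk η' hη'⟩)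
      have h1 := (hf' o η hη τ).2 ⟨hτ, (heq.trans hmk.symm)⟩
      have h2 := (hf' o' η' hη' τ).2 ⟨hτ, hmk.symm⟩
      have h3 := (h1.fiberCharacters_eq ((isIrr_iff _).1 hη).1).symm.trans
        (h2.fiberCharacters_eq ((isIrr_iff _).1 hη').1)
      have hoo : o = o' := by
        apply Subtype.ext
        rw [← MulAction.orbitRel.Quotient.mem_orbit.1 (hr o.1),
          ← MulAction.orbitRel.Quotient.mem_orbit.1 (hr o'.1)]
        exact MulAction.orbitRel.Quotient.orbit_injective h3
      subst hoo
      congr 1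
      exact RepVar.mk_eq_mk.2 (h1.exists_conj_of_isInd h2)
    · intro q
      induction q using Quotient.inductionOn' with
      | h a =>
      obtain ⟨τ, hτ⟩ := a
      have hτ' := (isIrr_comp_mulEquiv eM τ).2 hτ
      obtain ⟨χ, hχ⟩ := fiberCharacters_nonempty (τ.comp eM.toMonoidHom) (by omega)
      let o : MulAction.orbitRel.Quotient Γ (DualTorus ρ) := Quotient.mk'' χ
      obtain ⟨γ, hγ⟩ : r o ∈ MulAction.orbit Γ χ := hr o
      have hξ : r o ∈ fiberCharacters (τ.comp eM.toMonoidHom) := by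
        rw [← hγ]; exact smul_mem_fiberCharacters hχ γ
      obtain ⟨k, η, hη, hind⟩ := exists_isInd hτ' hξ
      have hidx : (crossedIsotropy (r o)).index = orbitOrder o := by
        rw [index_crossedIsotropy, orbitOrder_eq (hr o)]
      have hfi := finiteIndex_crossedIsotropy (orbit_finite_of_mem_fiberCharacters hξ)
      have h0 : orbitOrder o ≠ 0 := hidx ▸ hfi.index_ne_zero
      have hnk : n = orbitOrder o * k := by
        rw [← hidx]; exact IsInducedFrom.eq_index_mul hind
      obtain rfl : k = n / orbitOrder o := by
        rw [hnk, Nat.mul_div_cancel_left _ (Nat.pos_of_ne_zero h0)]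
      obtain ⟨_, h⟩ := (hf' ⟨o, ⟨_, hnk⟩⟩ η hη τ).1 hind
      exact ⟨_, h⟩
  exact ⟨Equiv.ofBijective f hbij, hf'⟩

theorem ncard_fiberCharacters_eq_iff (hn : 1 ≤ n) {τ : Crossed ρ →* U n} (hτ : IsIrr τ) :
    (fiberCharacters τ).ncard = n ↔ ∃ (ξ : DualTorus ρ) (η : Isotropy ξ →* U 1),
      Nat.card (MulAction.orbit Γ ξ) = n ∧ IsInd ξ η τ := by
  constructor
  · intro h
    obtain ⟨ξ, hξ⟩ := fiberCharacters_nonempty τ (by omega)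
    obtain ⟨k, η, hη, hind⟩ := exists_isInd hτ hξ
    rw [hind.fiberCharacters_eq ((isIrr_iff _).1 hη).1] at h
    have hcard : Nat.card (MulAction.orbit Γ ξ) = n := h
    have hfi : (crossedIsotropy ξ).FiniteIndex := ⟨by rw [index_crossedIsotropy]; omega⟩
    have h1 := IsInducedFrom.eq_index_mul hind
    rw [index_crossedIsotropy, hcard] at h1
    obtain rfl : k = 1 := by
      have : n * k = n * 1 := by omega
      exact Nat.eq_of_mul_eq_mul_left hn this
    exact ⟨ξ, η, hcard, hind⟩
  · rintro ⟨ξ, η, hcard, hind⟩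
    rw [hind.fiberCharacters_eq one_ne_zero]
    exact hcard

end Parametrization

/-- The fundamental group of the base of a simply connected quotient covering is the deck group;
a deck transformation `g` corresponds to the image of a path from the base point `e` to `g e`. -/
theorem exists_mulEquiv_pi1 {G E Y : Type*} [Group G] [TopologicalSpace E] [TopologicalSpace Y]
    [MulAction G E] [SimplyConnectedSpace E] {p : E → Y} (hp : IsQuotientCoveringMap p G) (e : E) :
    ∃ φ : G ≃* Pi1 Y (p e), ∀ (g : G) (γ : Path e (g • e)) (l : Path (p e) (p e)),
      (∀ t, l t = p (γ t)) →
        φ g = MulOpposite.op (FundamentalGroup.fromPath (Path.Homotopic.Quotient.mk l)) := by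
  let ψ := hp.fundamentalGroupEquiv (⟨e, rfl⟩ : p ⁻¹' {p e})
  refine ⟨(MulEquiv.opOp G).trans (MulEquiv.op ψ.symm), fun g γ l hl => ?_⟩
  change MulOpposite.op (ψ.symm (MulOpposite.op g)) = _
  congr 1
  rw [MulEquiv.symm_apply_eq]
  symm
  refine hp.fundamentalGroupToMulOpposite_apply_eq_Iff.2 ?_
  have hend : p (g • e) = p e := hp.map_smul g
  have h := hp.isCoveringMap.monodromy_eq_of_map_eq (γ := Path.Homotopic.Quotient.mk l)
    (ex := ⟨e, rfl⟩) (ey := ⟨g • e, hend⟩) (Path.Homotopic.Quotient.mk γ) ?_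
  · exact (congrArg Subtype.val h).symm
  · have h1 : γ.map hp.isCoveringMap.continuous = l.cast rfl hend := by
      ext t
      exact (hl t).symm
    exact congrArg Path.Homotopic.Quotient.mk h1

section Formulas

variable {Γ : Type*} [Group Γ] {d : ℕ} (ρ : Γ →* GL (Fin d) ℤ) {X : Type*} [MulAction Γ X]

theorem smul_cover (g : Crossed ρ) (w : Cover ρ X) : g • w = (g.right • w.1,
    ((ρ g.right).1.map (Int.cast : ℤ → ℝ)).mulVec w.2 + fun i => ((g.left.toAdd i : ℤ) : ℝ)) := rfl

theorem totalToBase_coverProj (w : Cover ρ X) :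
    totalToBase ρ X (coverProj ρ X w) = baseProj Γ X w.1 := rfl

theorem dualToBase_leafProj {ρ : Γ →* GL (Fin d) ℤ} (ξ : DualTorus ρ) (x : X) :
    dualToBase ρ X (leafProj X ξ x).1 = baseProj Γ X x := rfl

variable {ρ} (ξ : DualTorus ρ)

theorem leafProj_eq_iff {x x' : X} :
    leafProj X ξ x = leafProj X ξ x' ↔ x ∈ MulAction.orbit (Isotropy ξ) x' := by
  refine Subtype.ext_iff.trans ?_
  refine (Quotient.eq (r := MulAction.orbitRel Γ (X × DualTorus ρ))).trans ?_
  rw [MulAction.orbitRel_apply]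
  constructor
  · rintro ⟨γ, h⟩
    exact ⟨⟨γ, congrArg Prod.snd h⟩, congrArg Prod.fst h⟩
  · rintro ⟨γ, rfl⟩
    exact ⟨γ.1, Prod.ext rfl γ.2⟩

end Formulas

section Coverings

variable {Γ : Type*} [Group Γ] {d : ℕ} (ρ : Γ →* GL (Fin d) ℤ) {X : Type*} [TopologicalSpace X]
  [MulAction Γ X]

instance [SimplyConnectedSpace X] : SimplyConnectedSpace (Cover ρ X) := by
  obtain ⟨h⟩ := ContractibleSpace.hequiv_unit (Fin d → ℝ)
  have e : ContinuousMap.HomotopyEquiv (Cover ρ X) X :=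
    ((ContinuousMap.HomotopyEquiv.refl X).prodCongr h).trans
      (Homeomorph.prodPUnit X).toHomotopyEquiv
  exact e.simplyConnectedSpace

instance : ContinuousConstSMul Γ (Torus ρ) where
  continuous_const_smul γ := by
    change Continuous fun (t : Fin d → UnitAddCircle) i => ∑ j, (ρ γ).1 i j • t j
    fun_prop

instance : ContinuousConstSMul Γ (DualTorus ρ) where
  continuous_const_smul γ := by
    rw [continuous_induced_rng, continuous_pi_iff]
    intro a
    exact (continuous_apply (latticeAct ρ γ⁻¹ a)).comp continuous_induced_dom

instance : T2Space (DualTorus ρ) :=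
  T2Space.of_injective_continuous (f := fun (ξ : DualTorus ρ) (a : Lattice d) => ξ.char a)
    (fun _ _ h => DualTorus.ext_char (congrFun h)) continuous_induced_dom

/-- The projection `ℝᵈ → T`. -/
def torusMk (y : Fin d → ℝ) : Torus ρ := fun i => ((y i : ℝ) : UnitAddCircle)

theorem isOpenQuotientMap_torusMk : IsOpenQuotientMap (torusMk ρ) :=
  IsOpenQuotientMap.piMap fun _ => QuotientAddGroup.isOpenQuotientMap_mk

theorem smul_torusMk (γ : Γ) (y : Fin d → ℝ) :
    γ • torusMk ρ y = torusMk ρ (((ρ γ).1.map (Int.cast : ℤ → ℝ)).mulVec y) := by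
  funext i
  change ∑ j, (ρ γ).1 i j • ((y j : ℝ) : UnitAddCircle) =
    ((∑ j, ((ρ γ).1 i j : ℝ) * y j : ℝ) : UnitAddCircle)
  refine Eq.trans ?_ (map_sum (QuotientAddGroup.mk' (AddSubgroup.zmultiples (1 : ℝ)))
    (fun j => ((ρ γ).1 i j : ℝ) * y j) Finset.univ).symm
  refine Finset.sum_congr rfl fun j _ => ?_
  rw [← zsmul_eq_mul, map_zsmul]
  rfl

theorem torusMk_eq_iff {y y' : Fin d → ℝ} :
    torusMk ρ y = torusMk ρ y' ↔ ∃ a : Lattice d, y = y' + fun i => ((a.toAdd i : ℤ) : ℝ) := by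
  constructor
  · intro h
    have h1 : ∀ i, ∃ m : ℤ, m • (1 : ℝ) = y i - y' i := by
      intro i
      rw [← AddCircle.coe_eq_zero_iff (p := (1 : ℝ)), AddCircle.coe_sub, sub_eq_zero]
      exact congrFun h i
    choose m hm using h1
    refine ⟨.ofAdd m, funext fun i => ?_⟩
    have := hm i
    simp only [zsmul_eq_mul, mul_one] at this
    simp [this]
  · rintro ⟨a, rfl⟩
    funext i
    change ((y' i + (a.toAdd i : ℤ) : ℝ) : UnitAddCircle) = ((y' i : ℝ) : UnitAddCircle)
    rw [← sub_eq_zero, ← AddCircle.coe_sub, AddCircle.coe_eq_zero_iff]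
    exact ⟨a.toAdd i, by simp⟩

theorem coverProj_eq_iff (X : Type*) [MulAction Γ X] {w w' : Cover ρ X} :
    coverProj ρ X w = coverProj ρ X w' ↔ w ∈ MulAction.orbit (Crossed ρ) w' := by
  refine (Quotient.eq (r := MulAction.orbitRel Γ (X × Torus ρ))).trans ?_
  rw [MulAction.orbitRel_apply]
  constructor
  · rintro ⟨γ, h⟩
    have h1 : γ • w'.1 = w.1 := congrArg Prod.fst h
    have h2 : γ • torusMk ρ w'.2 = torusMk ρ w.2 := congrArg Prod.snd h
    rw [smul_torusMk] at h2
    obtain ⟨a, ha⟩ := (torusMk_eq_iff ρ).1 h2.symm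
    refine ⟨⟨a, γ⟩, ?_⟩
    change (⟨a, γ⟩ : Crossed ρ) • w' = w
    rw [smul_cover]
    exact Prod.ext h1 ha.symm
  · rintro ⟨g, rfl⟩
    refine ⟨g.right, Prod.ext rfl ?_⟩
    change g.right • torusMk ρ w'.2 = torusMk ρ (g • w').2
    rw [smul_torusMk, eq_comm, torusMk_eq_iff]
    exact ⟨g.left, rfl⟩

variable (X)

theorem isOpenQuotientMap_coverProj [ContinuousConstSMul Γ X] :
    IsOpenQuotientMap (coverProj ρ X) :=
  (MulAction.isOpenQuotientMap_quotientMk (T := X × Torus ρ) (Γ := Γ)).comp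
    (IsOpenQuotientMap.id.prodMap (isOpenQuotientMap_torusMk ρ))

variable {X}

/-- The covering of the torus bundle by `X × ℝᵈ`. -/
theorem isQuotientCoveringMap_coverProj (hX : IsQuotientCoveringMap (baseProj Γ X) Γ) :
    IsQuotientCoveringMap (coverProj ρ X) (Crossed ρ) := by
  have := hX.toContinuousConstSMul
  refine (isQuotientCoveringMap_iff _ _).2 ⟨(isOpenQuotientMap_coverProj ρ X).isQuotientMap, ⟨?_⟩,
    coverProj_eq_iff ρ X, ?_⟩
  · intro g
    change Continuous fun w : X × (Fin d → ℝ) => (g.right • w.1,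
      ((ρ g.right).1.map (Int.cast : ℤ → ℝ)).mulVec w.2 + fun i => ((g.left.toAdd i : ℤ) : ℝ))
    fun_prop
  · rintro ⟨x, y⟩
    obtain ⟨N, hN, hN'⟩ := hX.disjoint x
    refine ⟨N ×ˢ Metric.ball y (1 / 2), prod_mem_nhds hN (Metric.ball_mem_nhds y (by norm_num)), ?_⟩
    rintro g ⟨_, ⟨w, hw, rfl⟩, hw'⟩
    have hγ : g.right = 1 := hN' _ ⟨_, ⟨w.1, hw.1, rfl⟩, hw'.1⟩
    have h1 : (g • w).2 = w.2 + fun i => ((g.left.toAdd i : ℤ) : ℝ) := by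
      rw [smul_cover]
      funext i
      simp [hγ]
    have h2 : ((g • w).2 : Fin d → ℝ) ∈ Metric.ball y (1 / 2) := hw'.2
    have h3 : dist (w.2 + fun i => ((g.left.toAdd i : ℤ) : ℝ)) w.2 < 1 := by
      rw [← h1]
      have h4 := dist_triangle_right (g • w).2 w.2 y
      have h5 := Metric.mem_ball.1 h2
      have h6 := Metric.mem_ball.1 hw.2
      linarith
    rw [dist_self_add_left] at h3
    apply SemidirectProduct.ext
    · apply Multiplicative.toAdd.injective
      funext i
      have h7 := (norm_le_pi_norm (fun i => ((g.left.toAdd i : ℤ) : ℝ)) i).trans_lt h3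
      rw [Real.norm_eq_abs, ← Int.cast_abs] at h7
      have h8 : |g.left.toAdd i| < 1 := by exact_mod_cast h7
      exact Int.abs_lt_one_iff.1 h8
    · exact hγ

section Leaf

variable {ρ} (ξ : DualTorus ρ)

theorem continuous_leafProj : Continuous (leafProj X ξ) :=
  Continuous.subtype_mk (continuous_quot_mk.comp (by fun_prop)) _

theorem isOpenMap_leafProj [ContinuousConstSMul Γ X] (hfin : (MulAction.orbit Γ ξ).Finite) :
    IsOpenMap (leafProj X ξ) := by
  intro N hN
  have hV : (MulAction.orbit Γ ξ \ {ξ})ᶜ ∈ 𝓝 ξ :=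
    (hfin.subset Set.sdiff_subset).isClosed.isOpen_compl.mem_nhds (by simp)
  obtain ⟨V, hVs, hVo, hξV⟩ := mem_nhds_iff.1 hV
  have ho : IsOpen (dualProj ρ X '' (N ×ˢ V)) :=
    (MulAction.isOpenQuotientMap_quotientMk (T := X × DualTorus ρ) (Γ := Γ)).isOpenMap _
      (hN.prod hVo)
  refine isOpen_induced_iff.2 ⟨_, ho, ?_⟩
  ext ⟨_, x, rfl⟩
  constructor
  · rintro ⟨⟨x', ζ⟩, ⟨hx', hζ⟩, h⟩
    have h' := Quotient.exact (s := MulAction.orbitRel Γ (X × DualTorus ρ)) h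
    obtain ⟨γ, hγ⟩ := MulAction.orbitRel_apply.1 h'
    have h1 : γ • x = x' := congrArg Prod.fst hγ
    have h2 : γ • ξ = ζ := congrArg Prod.snd hγ
    have h3 : ζ = ξ := by
      by_contra hne
      exact hVs hζ ⟨⟨γ, h2⟩, hne⟩
    exact ⟨x', hx', Subtype.ext (h3 ▸ h)⟩
  · rintro ⟨x', hx', h⟩
    exact ⟨(x', ξ), ⟨hx', hξV⟩, congrArg Subtype.val h⟩

/-- The covering of a leaf with finitely many sheets over the base. -/
theorem isQuotientCoveringMap_leafProj (hX : IsQuotientCoveringMap (baseProj Γ X) Γ)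
    (hfin : (MulAction.orbit Γ ξ).Finite) :
    IsQuotientCoveringMap (leafProj X ξ) (Isotropy ξ) := by
  have := hX.toContinuousConstSMul
  have hq : IsOpenQuotientMap (leafProj X ξ) :=
    ⟨by rintro ⟨_, x, rfl⟩; exact ⟨x, rfl⟩, continuous_leafProj ξ, isOpenMap_leafProj ξ hfin⟩
  refine (isQuotientCoveringMap_iff _ _).2 ⟨hq.isQuotientMap,
    ⟨fun γ => continuous_const_smul γ.1⟩, leafProj_eq_iff ξ, fun x => ?_⟩
  obtain ⟨N, hN, hN'⟩ := hX.disjoint x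
  exact ⟨N, hN, fun γ hγ => Subtype.ext (hN' γ.1 hγ)⟩

theorem leafProductProj_surjective (hX : IsQuotientCoveringMap (baseProj Γ X) Γ) :
    Function.Surjective (leafProductProj X ξ) := by
  have := hX.toContinuousConstSMul
  rintro ⟨⟨m, ⟨_, x, rfl⟩⟩, h⟩
  obtain ⟨w, rfl⟩ := (isOpenQuotientMap_coverProj ρ X).surjective m
  obtain ⟨γ, hγ⟩ := hX.apply_eq_iff_mem_orbit.1 h.symm
  have hγ' : γ • w.1 = x := hγ
  subst hγ'
  refine ⟨(SemidirectProduct.inr γ : Crossed ρ) • w, Subtype.ext (Prod.ext ?_ rfl)⟩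
  exact (coverProj_eq_iff ρ X).2 ⟨_, rfl⟩

theorem leafProductProj_eq_iff (hX : IsQuotientCoveringMap (baseProj Γ X) Γ) {w w' : Cover ρ X} :
    leafProductProj X ξ w = leafProductProj X ξ w' ↔
      w ∈ MulAction.orbit (crossedIsotropy ξ) w' := by
  constructor
  · intro h
    have h1 : coverProj ρ X w = coverProj ρ X w' := congrArg (fun z => z.1.1) h
    have h2 : leafProj X ξ w.1 = leafProj X ξ w'.1 := congrArg (fun z => z.1.2) h
    obtain ⟨g, rfl⟩ := (coverProj_eq_iff ρ X).1 h1
    obtain ⟨γ, hγ⟩ := (leafProj_eq_iff ξ).1 h2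
    have h3 : γ.1 = g.right := hX.isCancelSMul.right_cancel _ _ _ hγ
    exact ⟨⟨g, by rw [mem_crossedIsotropy, ← h3]; exact γ.2⟩, rfl⟩
  · rintro ⟨g, rfl⟩
    refine Subtype.ext (Prod.ext ((coverProj_eq_iff ρ X).2 ⟨g.1, rfl⟩)
      ((leafProj_eq_iff ξ).2 ⟨⟨g.1.right, g.2⟩, rfl⟩))

theorem continuous_leafProductProj [ContinuousConstSMul Γ X] :
    Continuous (leafProductProj X ξ) :=
  Continuous.subtype_mk ((isOpenQuotientMap_coverProj ρ X).continuous.prodMk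
    ((continuous_leafProj ξ).comp continuous_fst)) _

theorem isOpenMap_leafProductProj (hX : IsQuotientCoveringMap (baseProj Γ X) Γ)
    (hfin : (MulAction.orbit Γ ξ).Finite) : IsOpenMap (leafProductProj X ξ) := by
  have := hX.toContinuousConstSMul
  rw [isOpenMap_iff_nhds_le]
  rintro ⟨x, y⟩ s hs
  have hs' : leafProductProj X ξ ⁻¹' s ∈ 𝓝 x ×ˢ 𝓝 y := by rw [← nhds_prod_eq]; exact hs
  obtain ⟨N, hN, N', hN', hNs⟩ := Filter.mem_prod_iff.1 hs'
  obtain ⟨D, hD, hD'⟩ := hX.disjoint x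
  have hND := Filter.inter_mem hN hD
  have h1 : coverProj ρ X '' ((N ∩ D) ×ˢ N') ∈ 𝓝 (coverProj ρ X (x, y)) :=
    (isOpenQuotientMap_coverProj ρ X).isOpenMap.image_mem_nhds (prod_mem_nhds hND hN')
  have h2 : leafProj X ξ '' (N ∩ D) ∈ 𝓝 (leafProj X ξ x) :=
    (isOpenMap_leafProj ξ hfin).image_mem_nhds hND
  have c1 : Continuous fun z : LeafProduct X ξ => z.1.1 :=
    continuous_fst.comp continuous_subtype_val
  have c2 : Continuous fun z : LeafProduct X ξ => z.1.2 :=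
    continuous_snd.comp continuous_subtype_val
  refine Filter.mem_of_superset (Filter.inter_mem
    (c1.continuousAt (x := leafProductProj X ξ (x, y)) h1)
    (c2.continuousAt (x := leafProductProj X ξ (x, y)) h2)) ?_
  rintro z ⟨⟨w, hw, hwz⟩, ⟨x', hx', hxz⟩⟩
  have hb : baseProj Γ X x' = baseProj Γ X w.1 := by
    rw [← dualToBase_leafProj ξ, ← totalToBase_coverProj, hxz, hwz]
    exact z.2.symm
  obtain ⟨γ, hγ⟩ := hX.apply_eq_iff_mem_orbit.1 hb
  have h3 : γ = 1 := hD' γ ⟨x', ⟨w.1, hw.1.2, hγ⟩, hx'.2⟩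
  have h4 : w.1 = x' := by rw [← hγ, h3]; simp
  have h5 : leafProductProj X ξ w = z :=
    Subtype.ext (Prod.ext hwz ((congrArg (leafProj X ξ) h4).trans hxz))
  rw [← h5]
  exact hNs ⟨hw.1.1, hw.2⟩

/-- The covering of the fibre product of the torus bundle with a leaf by `X × ℝᵈ`. -/
theorem isQuotientCoveringMap_leafProductProj (hX : IsQuotientCoveringMap (baseProj Γ X) Γ)
    (hfin : (MulAction.orbit Γ ξ).Finite) :
    IsQuotientCoveringMap (leafProductProj X ξ) (crossedIsotropy ξ) := by
  have := hX.toContinuousConstSMul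
  have hM := isQuotientCoveringMap_coverProj ρ hX
  have hM' := hM.toContinuousConstSMul
  have hq : IsOpenQuotientMap (leafProductProj X ξ) :=
    ⟨leafProductProj_surjective ξ hX, continuous_leafProductProj ξ,
      isOpenMap_leafProductProj ξ hX hfin⟩
  refine (isQuotientCoveringMap_iff _ _).2 ⟨hq.isQuotientMap,
    ⟨fun g => continuous_const_smul g.1⟩, leafProductProj_eq_iff ξ hX, fun w => ?_⟩
  obtain ⟨N, hN, hN'⟩ := hM.disjoint w
  exact ⟨N, hN, fun g hg => Subtype.ext (hN' g.1 hg)⟩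

end Leaf

end Coverings

universe u

namespace FlatFamily

theorem Iso.trans {Y : Type u} [TopologicalSpace Y] {E F K : FlatFamily Y} (h : E.Iso F)
    (h' : F.Iso K) : E.Iso K := by
  obtain ⟨φ, hφ⟩ := h
  obtain ⟨ψ, hψ⟩ := h'
  exact ⟨fun y => (φ y).trans (ψ y), fun s y => (hφ s y).trans (hψ _ y)⟩

theorem Iso.push {Y Z : Type u} [TopologicalSpace Y] [TopologicalSpace Z] (p : Z → Y)
    {E F : FlatFamily Z} (h : E.Iso F) : (E.push p).Iso (F.push p) := by
  obtain ⟨φ, hφ⟩ := h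
  exact ⟨fun y => LinearEquiv.piCongrRight fun z : {z : Z // p z = y} => φ z.1,
    fun s y => forall_congr' fun z => forall_congr' fun _ => hφ _ z⟩

section Assoc

variable {G : Type*} [Group G] {W Y : Type u} [TopologicalSpace W] [TopologicalSpace Y]
  [MulAction G W] {q : W → Y} {k : ℕ} {τ : G →* U k}

/-- The value of a vector of an associated bundle at a point of the covering. -/
def assocVal {y : Y} (w : {w : W // q w = y}) : (assoc q τ).fiber y →ₗ[ℂ] (Fin k → ℂ) where
  toFun f := Subtype.val f w
  map_add' _ _ := rfl
  map_smul' _ _ := rfl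

theorem assocVal_smul {y : Y} (f : (assoc q τ).fiber y) (g : G) (w w' : {w : W // q w = y})
    (h : w'.1 = g • w.1) : assocVal w' f = toRep τ g (assocVal w f) := f.2 g w w' h

theorem assoc_ext {y : Y} {f f' : (assoc q τ).fiber y} (h : ∀ w, assocVal w f = assocVal w f') :
    f = f' := Subtype.ext (funext h)

/-- A vector of an associated bundle given by an equivariant function. -/
def assocMk {y : Y} (f : {w : W // q w = y} → (Fin k → ℂ))
    (hf : ∀ (g : G) (w w' : {w : W // q w = y}), w'.1 = g • w.1 → f w' = toRep τ g (f w)) :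
    (assoc q τ).fiber y := ⟨f, hf⟩

theorem assocVal_assocMk {y : Y} (f : {w : W // q w = y} → (Fin k → ℂ))
    (hf : ∀ (g : G) (w w' : {w : W // q w = y}), w'.1 = g • w.1 → f w' = toRep τ g (f w))
    (w : {w : W // q w = y}) :
    assocVal w (assocMk f hf) = f w := rfl

theorem assoc_flatAt_iff (s : ∀ y, (assoc q τ).fiber y) (y : Y) :
    (assoc q τ).FlatAt s y ↔ ∀ w : W, q w = y →
      ∀ᶠ w' in 𝓝 w, assocVal ⟨w', rfl⟩ (s (q w')) = assocVal ⟨w, rfl⟩ (s (q w)) := Iff.rfl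

theorem assocVal_section (s : ∀ y, (assoc q τ).fiber y) {y : Y} (w : {w : W // q w = y}) :
    assocVal w (s y) = assocVal ⟨w.1, rfl⟩ (s (q w.1)) := by
  obtain ⟨w, rfl⟩ := w
  rfl

variable (τ)

/-- Evaluation at a point of the covering identifies the fibre of an associated bundle with
`ℂᵏ`. -/
def assocEquiv (hq : IsQuotientCoveringMap q G) {y : Y} (w : {w : W // q w = y}) :
    (assoc q τ).fiber y ≃ₗ[ℂ] (Fin k → ℂ) :=
  LinearEquiv.ofBijective (assocVal w) (by
    constructor
    · intro f f' h
      apply assoc_ext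
      intro w'
      obtain ⟨g, hg⟩ := hq.apply_eq_iff_mem_orbit.1 (w'.2.trans w.2.symm)
      rw [assocVal_smul f g w w' hg.symm, assocVal_smul f' g w w' hg.symm, h]
    · intro v
      have hex : ∀ w' : {w : W // q w = y}, ∃ g : G, g • w.1 = w'.1 := fun w' =>
        hq.apply_eq_iff_mem_orbit.1 (w'.2.trans w.2.symm)
      choose c hc using hex
      have hcancel := hq.isCancelSMul.right_cancel
      refine ⟨assocMk (fun w' => toRep τ (c w') v) ?_, ?_⟩
      · intro g w₁ w₂ h
        have h1 : c w₂ = g * c w₁ := by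
          apply hcancel _ _ w.1
          rw [hc, mul_smul, hc, h]
        rw [h1, map_mul, Module.End.mul_apply]
      · have h1 : c w = 1 := by
          apply hcancel _ _ w.1
          rw [hc, one_smul]
        rw [assocVal_assocMk, h1]
        simp)

theorem assocEquiv_apply (hq : IsQuotientCoveringMap q G) {y : Y} (w : {w : W // q w = y})
    (f : (assoc q τ).fiber y) : assocEquiv τ hq w f = assocVal w f := rfl

theorem assocVal_assocEquiv_symm (hq : IsQuotientCoveringMap q G) {y : Y}
    (w : {w : W // q w = y}) (v : Fin k → ℂ) : assocVal w ((assocEquiv τ hq w).symm v) = v :=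
  (assocEquiv τ hq w).apply_symm_apply v

/-- Associated bundles have local flat sections with prescribed value. -/
theorem exists_flatAt (hq : IsQuotientCoveringMap q G) (w₀ : W) (v : Fin k → ℂ) :
    ∃ t : ∀ y, (assoc q τ).fiber y, (assoc q τ).FlatAt t (q w₀) ∧
      ∀ᶠ w in 𝓝 w₀, assocVal ⟨w, rfl⟩ (t (q w)) = v := by
  classical
  have := hq.toContinuousConstSMul
  obtain ⟨N, hN, hN'⟩ := hq.disjoint w₀
  let t : ∀ y, (assoc q τ).fiber y := fun y =>
    if h : ∃ w : {w : W // q w = y}, w.1 ∈ N then (assocEquiv τ hq h.choose).symm v else 0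
  have ht : ∀ w ∈ N, assocVal ⟨w, rfl⟩ (t (q w)) = v := by
    intro w hw
    have h : ∃ w' : {w' : W // q w' = q w}, w'.1 ∈ N := ⟨⟨w, rfl⟩, hw⟩
    have h1 : h.choose = ⟨w, rfl⟩ := by
      obtain ⟨g, hg⟩ := hq.apply_eq_iff_mem_orbit.1 h.choose.2
      have h2 : g = 1 := hN' g ⟨h.choose.1, ⟨w, hw, hg⟩, h.choose_spec⟩
      apply Subtype.ext
      rw [← hg, h2]
      exact one_smul G w
    simp only [t, dif_pos h]
    rw [h1, assocVal_assocEquiv_symm]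
  refine ⟨t, (assoc_flatAt_iff _ _).2 fun w hw => ?_, Filter.mem_of_superset hN ht⟩
  obtain ⟨g, rfl⟩ := hq.apply_eq_iff_mem_orbit.1 hw
  have hval : ∀ w', g⁻¹ • w' ∈ N → assocVal ⟨w', rfl⟩ (t (q w')) = toRep τ g v := by
    intro w' hw'
    have h1 : q (g⁻¹ • w') = q w' := hq.map_smul _
    rw [assocVal_smul (t (q w')) g ⟨g⁻¹ • w', h1⟩ ⟨w', rfl⟩ (smul_inv_smul g w').symm,
      assocVal_section t, ht _ hw']
  have hc : ∀ᶠ w' in 𝓝 (g • w₀), g⁻¹ • w' ∈ N := by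
    have hcont : ContinuousAt (fun w' : W => g⁻¹ • w') (g • w₀) :=
      (continuous_const_smul g⁻¹).continuousAt
    apply hcont
    simpa only [inv_smul_smul] using hN
  have h0 := hval _ hc.self_of_nhds
  filter_upwards [hc] with w' hw'
  exact (hval w' hw').trans h0.symm

end Assoc

/-- The push-down of the bundle associated to `σ` is the bundle associated to the representation
induced from `σ`. -/
theorem push_assoc_iso {G : Type*} [Group G] {W Y Z : Type u} [TopologicalSpace W]
    [TopologicalSpace Y] [TopologicalSpace Z] [MulAction G W] [ContinuousConstSMul G W]
    (H : Subgroup G) [H.FiniteIndex] (q : W → Z) (p : Z → Y) {k n : ℕ} {σ : H →* U k}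
    {τ : G →* U n} (hq : ∀ (h : H) w, q (h • w) = q w) (hp : ∀ (g : G) w, p (q (g • w)) = p (q w))
    (hind : IsInducedFrom H σ τ) :
    ((assoc q σ).push p).Iso (assoc (fun w => p (q w)) τ) := by
  obtain ⟨e, he, -⟩ := hind
  let val : ∀ {y : Y} (_ : ((assoc q σ).push p).fiber y) (w : {w : W // p (q w) = y}),
      Fin k → ℂ := fun s w => assocVal ⟨w.1, rfl⟩ (s ⟨q w.1, w.2⟩)
  have hval : ∀ {y : Y} (s : ((assoc q σ).push p).fiber y) (z : {z : Z // p z = y})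
      (w : {w : W // q w = z.1}), assocVal w (s z) = val s ⟨w.1, by rw [w.2, z.2]⟩ := by
    rintro y s ⟨z, hz⟩ ⟨w, hw⟩
    change q w = z at hw
    subst hw
    rfl
  have hvalH : ∀ {y : Y} (s : ((assoc q σ).push p).fiber y) (w w' : {w : W // p (q w) = y})
      (h : H), w'.1 = h • w.1 → val s w' = toRep σ h (val s w) := by
    intro y s w w' h hw
    have h1 : q w'.1 = q w.1 := by rw [hw, hq]
    have h2 := hval s ⟨q w.1, w.2⟩ ⟨w'.1, h1⟩
    rw [← assocVal_smul (s ⟨q w.1, w.2⟩) h ⟨w.1, rfl⟩ ⟨w'.1, h1⟩ hw, h2]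
  let F : ∀ {y : Y} (_ : ((assoc q σ).push p).fiber y) (_ : {w : W // p (q w) = y}),
      Representation.coindV H.subtype (toRep σ) := fun s w =>
    ⟨fun g => val s ⟨g • w.1, by rw [hp, w.2]⟩, fun h g => hvalH s _ _ h (mul_smul _ _ _)⟩
  have hF : ∀ {y : Y} (s : ((assoc q σ).push p).fiber y) (w : {w : W // p (q w) = y}) (g : G),
      (F s w).1 g = val s ⟨g • w.1, by rw [hp, w.2]⟩ := fun s w g => rfl
  let φ : ∀ y, ((assoc q σ).push p).fiber y ≃ₗ[ℂ] (assoc (fun w => p (q w)) τ).fiber y := fun y =>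
    { toFun := fun s => assocMk (fun w => e.symm (F s w)) (by
        intro g w w' h
        apply e.injective
        rw [he, e.apply_symm_apply, e.apply_symm_apply]
        apply Subtype.ext
        funext g'
        change (F s w').1 g' = (F s w).1 (g' * g)
        rw [hF, hF]
        congr 2
        rw [h, mul_smul])
      invFun := fun f z => assocMk (fun w => (e (assocVal ⟨w.1, by rw [w.2, z.2]⟩ f)).1 1) (by
        intro h w w' hw
        rw [assocVal_smul f h.1 ⟨w.1, by rw [w.2, z.2]⟩ ⟨w'.1, by rw [w'.2, z.2]⟩ hw, he,
          ← coindV_apply_mul]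
        change (e _).1 (1 * h.1) = (e _).1 (h.1 * 1)
        rw [one_mul, mul_one])
      map_add' := fun s s' => assoc_ext fun w => e.symm.map_add (F s w) (F s' w)
      map_smul' := fun c s => assoc_ext fun w => e.symm.map_smul c (F s w)
      left_inv := fun s => funext fun z => assoc_ext fun w => by
        rw [assocVal_assocMk, assocVal_assocMk, e.apply_symm_apply, hF, hval]
        congr 2
        exact one_smul G w.1
      right_inv := fun f => assoc_ext fun w => by
        rw [assocVal_assocMk]
        apply e.injective
        rw [e.apply_symm_apply]
        apply Subtype.ext
        funext g
        change (e (assocVal ⟨g • w.1, _⟩ f)).1 1 = _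
        rw [assocVal_smul f g w ⟨g • w.1, by rw [hp, w.2]⟩ rfl, he]
        change (e _).1 (1 * g) = _
        rw [one_mul] }
  have hφ : ∀ (y : Y) s (w : {w : W // p (q w) = y}), assocVal w (φ y s) = e.symm (F s w) :=
    fun y s w => rfl
  refine ⟨φ, fun s y => ?_⟩
  let V : W → Fin k → ℂ := fun w => val (s (p (q w))) ⟨w, rfl⟩
  have hV : ∀ y (w : {w : W // p (q w) = y}), val (s y) w = V w.1 := by
    rintro y ⟨w, rfl⟩
    rfl
  have hFV : ∀ w g, (F (s (p (q w))) ⟨w, rfl⟩).1 g = V (g • w) := fun w g => by rw [hF, hV]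
  have h1 : ((assoc q σ).push p).FlatAt s y ↔
      ∀ w, p (q w) = y → ∀ᶠ w' in 𝓝 w, V w' = V w := by
    constructor
    · intro h w hw
      exact h (q w) hw w rfl
    · rintro h z hz w rfl
      exact h w hz
  rw [h1, assoc_flatAt_iff]
  simp only [hφ, EmbeddingLike.apply_eq_iff_eq]
  constructor
  · intro h w hw
    have h2 : ∀ c : Quotient (QuotientGroup.rightRel H),
        ∀ᶠ w' in 𝓝 w, V (c.out • w') = V (c.out • w) := fun c =>
      (continuous_const_smul c.out).continuousAt.eventually (h (c.out • w) (by rw [hp, hw]))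
    filter_upwards [Filter.eventually_all.2 h2] with w' hw'
    apply coindV_ext
    intro c
    rw [hFV, hFV, hw']
  · intro h w hw
    filter_upwards [h w hw] with w' hw'
    have h3 := congrArg (fun F => F.1 1) hw'
    simpa only [hFV, one_smul] using h3

end FlatFamily

section FourierMukai

open FlatFamily

variable {Γ : Type*} [Group Γ] {d : ℕ} {ρ : Γ →* GL (Fin d) ℤ} {X : Type u} [TopologicalSpace X]
  [MulAction Γ X] (ξ : DualTorus ρ)

/-- The value at `(w, ξ)` of a vector of the Poincaré bundle. -/
def poincareVal {z : LeafProduct X ξ} (w : {w : Cover ρ X // leafProductProj X ξ w = z}) :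
    (poincareLeaf X ξ).fiber z →ₗ[ℂ] ℂ where
  toFun f := Subtype.val (p := (· ∈ poincareFiber ρ X z.1.1 z.1.2.1)) f
    ⟨(w.1, ξ), congrArg (fun z => z.1.1) w.2, congrArg (fun z => z.1.2.1) w.2⟩
  map_add' _ _ := rfl
  map_smul' _ _ := rfl

theorem poincareVal_smul {z : LeafProduct X ξ} (f : (poincareLeaf X ξ).fiber z)
    (h : crossedIsotropy ξ) (w w' : {w : Cover ρ X // leafProductProj X ξ w = z})
    (hw : w'.1 = h • w.1) :
    poincareVal ξ w' f = (ξ.char h.1.left : ℂ) * poincareVal ξ w f := by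
  have hγ : h.1.right • ξ = ξ := h.2
  have hd : (SemidirectProduct.inl h.1.left : Crossed ρ) • (SemidirectProduct.inr h.1.right :
      Crossed ρ) • w.1 = w'.1 := by
    rw [hw, ← mul_smul, SemidirectProduct.inl_left_mul_inr_right]; rfl
  have hmem : leafProductProj X ξ ((SemidirectProduct.inr h.1.right : Crossed ρ) • w.1) = z := by
    refine Eq.trans ?_ w.2
    exact Subtype.ext (Prod.ext ((coverProj_eq_iff ρ X).2 ⟨_, rfl⟩)
      ((leafProj_eq_iff ξ).2 ⟨⟨h.1.right, h.2⟩, rfl⟩))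
  have h1 : poincareVal ξ ⟨(SemidirectProduct.inr h.1.right : Crossed ρ) • w.1, hmem⟩ f =
      poincareVal ξ w f := f.2.1 h.1.right _ _ (Prod.ext rfl hγ.symm)
  rw [← h1]
  exact f.2.2 h.1.left
    ⟨((SemidirectProduct.inr h.1.right : Crossed ρ) • w.1, ξ), congrArg (fun z => z.1.1) hmem,
      congrArg (fun z => z.1.2.1) hmem⟩
    ⟨(w'.1, ξ), congrArg (fun z => z.1.1) w'.2, congrArg (fun z => z.1.2.1) w'.2⟩
    (Prod.ext hd.symm rfl)

/-- Evaluation identifies the fibre of the Poincaré bundle with `ℂ`. -/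
def poincareEquiv (hX : IsQuotientCoveringMap (baseProj Γ X) Γ)
    {z : LeafProduct X ξ} (w : {w : Cover ρ X // leafProductProj X ξ w = z}) :
    (poincareLeaf X ξ).fiber z ≃ₗ[ℂ] ℂ :=
  LinearEquiv.ofBijective (poincareVal ξ w) (by
    obtain ⟨w, rfl⟩ := w
    have hM := isQuotientCoveringMap_coverProj ρ hX
    have hcancel := hM.isCancelSMul.right_cancel
    have hex : ∀ v : {v : Cover ρ X × DualTorus ρ // coverProj ρ X v.1 = coverProj ρ X w ∧
        dualProj ρ X (v.1.1, v.2) = dualProj ρ X (w.1, ξ)},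
        ∃ g : Crossed ρ, g • w = v.1.1 ∧ g.right • ξ = v.1.2 := by
      rintro ⟨⟨w', ζ⟩, h1, h2⟩
      obtain ⟨g, hg⟩ := (coverProj_eq_iff ρ X).1 h1
      have h3 := Quotient.exact (s := MulAction.orbitRel Γ (X × DualTorus ρ)) h2
      obtain ⟨γ, hγ⟩ := MulAction.orbitRel_apply.1 h3
      have h4 : γ • w.1 = w'.1 := congrArg Prod.fst hγ
      have h5 : γ • ξ = ζ := congrArg Prod.snd hγ
      have h6 : g.right • w.1 = w'.1 := congrArg Prod.fst hg
      have h7 : g.right = γ := hX.isCancelSMul.right_cancel _ _ _ (h6.trans h4.symm)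
      exact ⟨g, hg, by rw [h7, h5]⟩
    choose c hc hcξ using hex
    constructor
    · intro f f' h
      have h' : f.1 ⟨(w, ξ), rfl, rfl⟩ = f'.1 ⟨(w, ξ), rfl, rfl⟩ := h
      apply Subtype.ext
      funext v
      have hmem : coverProj ρ X ((SemidirectProduct.inr (c v).right : Crossed ρ) • w) =
          coverProj ρ X w ∧ dualProj ρ X (((SemidirectProduct.inr (c v).right : Crossed ρ) • w).1,
            (c v).right • ξ) = dualProj ρ X (w.1, ξ) :=
        ⟨(coverProj_eq_iff ρ X).2 ⟨_, rfl⟩,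
          Quotient.sound (s := MulAction.orbitRel Γ (X × DualTorus ρ)) ⟨(c v).right, rfl⟩⟩
      have hv : v.1 = ((SemidirectProduct.inl (c v).left : Crossed ρ) •
          (SemidirectProduct.inr (c v).right : Crossed ρ) • w, (c v).right • ξ) := by
        refine Prod.ext ?_ (hcξ v).symm
        rw [← mul_smul, SemidirectProduct.inl_left_mul_inr_right]
        exact (hc v).symm
      have key : ∀ f : poincareFiber ρ X (coverProj ρ X w) (dualProj ρ X (w.1, ξ)),
          f.1 v = (((c v).right • ξ).char (c v).left : ℂ) * f.1 ⟨(w, ξ), rfl, rfl⟩ := by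
        intro f
        rw [← f.2.1 (c v).right ⟨(w, ξ), rfl, rfl⟩
          ⟨((SemidirectProduct.inr (c v).right : Crossed ρ) • w, (c v).right • ξ), hmem⟩ rfl]
        exact f.2.2 (c v).left
          ⟨((SemidirectProduct.inr (c v).right : Crossed ρ) • w, (c v).right • ξ), hmem⟩ v hv
      exact (key f).trans ((congrArg _ h').trans (key f').symm)
    · intro b
      refine ⟨(⟨fun v => (v.1.2.char (c v).left : ℂ) * b, ?_, ?_⟩ :
        poincareFiber ρ X (coverProj ρ X w) (dualProj ρ X (w.1, ξ))), ?_⟩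
      · intro γ v v' h
        have h1 : c v' = SemidirectProduct.inr γ * c v := by
          apply hcancel _ _ w
          rw [hc, mul_smul, hc, h]
        have h2 : v'.1.2 = γ • v.1.2 := by rw [h]
        change (v'.1.2.char (c v').left : ℂ) * b = (v.1.2.char (c v).left : ℂ) * b
        rw [h1, h2, char_smul]
        simp
      · intro a v v' h
        have h1 : c v' = SemidirectProduct.inl a * c v := by
          apply hcancel _ _ w
          rw [hc, mul_smul, hc, h]
        have h2 : v'.1.2 = v.1.2 := by rw [h]
        change (v'.1.2.char (c v').left : ℂ) * b =
          (v.1.2.char a : ℂ) * ((v.1.2.char (c v).left : ℂ) * b)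
        rw [h1, h2]
        simp [mul_assoc]
      · have h1 : c ⟨(w, ξ), rfl, rfl⟩ = 1 := by
          apply hcancel _ _ w
          rw [hc, one_smul]
        change (ξ.char (c ⟨(w, ξ), rfl, rfl⟩).left : ℂ) * b = b
        rw [h1]
        simp)

theorem poincareVal_poincareEquiv_symm (hX : IsQuotientCoveringMap (baseProj Γ X) Γ)
    {z : LeafProduct X ξ}
    (w : {w : Cover ρ X // leafProductProj X ξ w = z}) (b : ℂ) :
    poincareVal ξ w ((poincareEquiv ξ hX w).symm b) = b :=
  (poincareEquiv ξ hX w).apply_symm_apply b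

/-- Around every point the Poincaré bundle over the leaf has a flat section with value `1`. -/
theorem poincareLeaf_exists_flatAt (hX : IsQuotientCoveringMap (baseProj Γ X) Γ)
    (hfin : (MulAction.orbit Γ ξ).Finite) (w₀ : Cover ρ X) :
    ∃ b : ∀ z, (poincareLeaf X ξ).fiber z, (poincareLeaf X ξ).FlatAt b (leafProductProj X ξ w₀) ∧
      ∀ᶠ w in 𝓝 w₀, poincareVal ξ ⟨w, rfl⟩ (b (leafProductProj X ξ w)) = 1 := by
  have hq := isQuotientCoveringMap_leafProductProj ξ hX hfin
  obtain ⟨t, ht, ht1⟩ := exists_flatAt (expRep ξ (1 : Isotropy ξ →* U 1)) hq w₀ 1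
  have hrep : ∀ (h : crossedIsotropy ξ) (x : Fin 1 → ℂ),
      toRep (expRep ξ (1 : Isotropy ξ →* U 1)) h x = (ξ.char h.1.left : ℂ) • x := by
    intro h x
    rw [toRep_expRep]
    simp [toRep_apply]
  choose p hp using hq.surjective
  let b : ∀ z, (poincareLeaf X ξ).fiber z := fun z =>
    (poincareEquiv ξ hX ⟨p z, hp z⟩).symm (assocVal ⟨p z, hp z⟩ (t z) 0)
  have hb : ∀ z (w : {w : Cover ρ X // leafProductProj X ξ w = z}),
      poincareVal ξ w (b z) = assocVal w (t z) 0 := by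
    intro z w
    obtain ⟨h, hh⟩ := hq.apply_eq_iff_mem_orbit.1 (w.2.trans (hp z).symm)
    rw [poincareVal_smul ξ (b z) h ⟨p z, hp z⟩ w hh.symm,
      assocVal_smul (t z) h ⟨p z, hp z⟩ w hh.symm, hrep, poincareVal_poincareEquiv_symm]
    rfl
  refine ⟨b, fun w hw => ?_, ?_⟩
  · filter_upwards [(assoc_flatAt_iff _ _).1 ht w hw] with w' hw'
    change poincareVal ξ ⟨w', rfl⟩ (b _) = poincareVal ξ ⟨w, rfl⟩ (b _)
    rw [hb, hb, hw']
  · filter_upwards [ht1] with w hw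
    rw [hb, hw]
    rfl

/-- The value at `x` of a vector of the local system of `η`. -/
def leafVal {k : ℕ} {η : Isotropy ξ →* U k} {y : Leaf X ξ} (x : {x : X // leafProj X ξ x = y}) :
    (leafSystem X ξ η).fiber y →ₗ[ℂ] (Fin k → ℂ) :=
  assocVal (q := leafProj X ξ) (τ := η) x

/-- The local system `p̂^* S_η ⊗ P` is associated to `(exp ξ, η)`. -/
theorem tensor_poincareLeaf_iso (hX : IsQuotientCoveringMap (baseProj Γ X) Γ)
    (hfin : (MulAction.orbit Γ ξ).Finite) {k : ℕ}
    (η : Isotropy ξ →* U k) :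
    (((leafSystem X ξ η).pull (pLeafHat X ξ)).tensor (poincareLeaf X ξ)).Iso
      (assoc (leafProductProj X ξ) (expRep ξ η)) := by
  have hq := isQuotientCoveringMap_leafProductProj ξ hX hfin
  have hl := isQuotientCoveringMap_leafProj ξ hX hfin
  have := hX.toContinuousConstSMul
  let lp : ∀ {z : LeafProduct X ξ} (_ : {w : Cover ρ X // leafProductProj X ξ w = z}),
      {x : X // leafProj X ξ x = pLeafHat X ξ z} := fun w =>
    ⟨w.1.1, congrArg (fun z => z.1.2) w.2⟩
  choose p hp using hq.surjective
  let φ : ∀ z, (((leafSystem X ξ η).pull (pLeafHat X ξ)).tensor (poincareLeaf X ξ)).fiber z ≃ₗ[ℂ]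
      (assoc (leafProductProj X ξ) (expRep ξ η)).fiber z := fun z =>
    ((TensorProduct.congr (assocEquiv η hl (lp ⟨p z, hp z⟩)) (poincareEquiv ξ hX ⟨p z, hp z⟩)).trans
      (TensorProduct.rid ℂ (Fin k → ℂ))).trans (assocEquiv (expRep ξ η) hq ⟨p z, hp z⟩).symm
  have hφ : ∀ (z : LeafProduct X ξ) (w : {w : Cover ρ X // leafProductProj X ξ w = z})
      (a : (leafSystem X ξ η).fiber (pLeafHat X ξ z)) (b : (poincareLeaf X ξ).fiber z),
      assocVal w (φ z (a ⊗ₜ[ℂ] b)) =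
        poincareVal ξ w b • leafVal ξ (lp w) a := by
    intro z w a b
    obtain ⟨h, hh⟩ := hq.apply_eq_iff_mem_orbit.1 (w.2.trans (hp z).symm)
    have h1 : assocVal ⟨p z, hp z⟩ (φ z (a ⊗ₜ[ℂ] b)) = poincareVal ξ ⟨p z, hp z⟩ b •
        leafVal ξ (lp ⟨p z, hp z⟩) a :=
      assocVal_assocEquiv_symm (expRep ξ η) hq _ _
    rw [assocVal_smul _ h ⟨p z, hp z⟩ w hh.symm, h1, poincareVal_smul ξ b h ⟨p z, hp z⟩ w hh.symm,
      toRep_expRep, map_smul, mul_smul]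
    congr 2
    refine (assocVal_smul (q := leafProj X ξ) (τ := η) a ⟨h.1.right, h.2⟩ (lp ⟨p z, hp z⟩) (lp w)
      ?_).symm
    exact (congrArg Prod.fst hh).symm
  have hφsum : ∀ (z : LeafProduct X ξ) (w : {w : Cover ρ X // leafProductProj X ξ w = z}) {m : ℕ}
      (a : Fin m → (leafSystem X ξ η).fiber (pLeafHat X ξ z))
      (b : Fin m → (poincareLeaf X ξ).fiber z),
      assocVal w (φ z (∑ i, a i ⊗ₜ[ℂ] b i : (leafSystem X ξ η).fiber (pLeafHat X ξ z) ⊗[ℂ]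
        (poincareLeaf X ξ).fiber z)) = ∑ i, poincareVal ξ w (b i) • leafVal ξ (lp w) (a i) := by
    intro z w m a b
    let T : (leafSystem X ξ η).fiber (pLeafHat X ξ z) ⊗[ℂ] (poincareLeaf X ξ).fiber z →ₗ[ℂ]
      (Fin k → ℂ) := assocVal w ∘ₗ (φ z).toLinearMap
    exact (map_sum T (fun i => a i ⊗ₜ[ℂ] b i) Finset.univ).trans
      (Finset.sum_congr rfl fun i _ => hφ z w _ _)
  refine ⟨φ, fun s z => ?_⟩
  rw [assoc_flatAt_iff]
  constructor
  · rintro ⟨m, a, b, ha, hb, hs⟩ w rfl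
    choose t ht hat using ha
    have hcont : Continuous fun w : Cover ρ X => w.1 := continuous_fst
    have h1 : ∀ᶠ w' in 𝓝 w, s (leafProductProj X ξ w') =
        ∑ i, (a i (leafProductProj X ξ w') ⊗ₜ[ℂ] b i (leafProductProj X ξ w')) :=
      (continuous_leafProductProj ξ).continuousAt.eventually hs
    have h2 : ∀ᶠ w' in 𝓝 w, ∀ i, a i (leafProductProj X ξ w') = t i (leafProj X ξ w'.1) :=
      Filter.eventually_all.2 fun i =>
        (continuous_leafProductProj ξ).continuousAt.eventually (hat i)
    have h3 : ∀ᶠ w' in 𝓝 w, ∀ i, poincareVal ξ ⟨w', rfl⟩ (b i (leafProductProj X ξ w')) =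
        poincareVal ξ ⟨w, rfl⟩ (b i (leafProductProj X ξ w)) :=
      Filter.eventually_all.2 fun i => hb i w rfl
    have h4 : ∀ᶠ w' in 𝓝 w, ∀ i,
        leafVal ξ ⟨w'.1, rfl⟩ (t i (leafProj X ξ w'.1)) =
          leafVal ξ ⟨w.1, rfl⟩ (t i (leafProj X ξ w.1)) :=
      Filter.eventually_all.2 fun i => hcont.continuousAt.eventually (ht i w.1 rfl)
    have hval : ∀ w', s (leafProductProj X ξ w') =
        ∑ i, (a i (leafProductProj X ξ w') ⊗ₜ[ℂ] b i (leafProductProj X ξ w')) →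
        (∀ i, a i (leafProductProj X ξ w') = t i (leafProj X ξ w'.1)) →
        assocVal ⟨w', rfl⟩ (φ _ (s (leafProductProj X ξ w'))) =
          ∑ i, poincareVal ξ ⟨w', rfl⟩ (b i (leafProductProj X ξ w')) •
            leafVal ξ ⟨w'.1, rfl⟩ (t i (leafProj X ξ w'.1)) := by
      intro w' e1 e2
      rw [e1]
      refine (hφsum _ ⟨w', rfl⟩ (fun i => a i (leafProductProj X ξ w')) _).trans
        (Finset.sum_congr rfl fun i _ => ?_)
      rw [e2 i]
      rfl
    have h0 := hval w h1.self_of_nhds h2.self_of_nhds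
    filter_upwards [h1, h2, h3, h4] with w' e1 e2 e3 e4
    rw [h0, hval w' e1 e2]
    exact Finset.sum_congr rfl fun i _ => by rw [e3, e4]
  · intro h
    obtain ⟨w₀, rfl⟩ := hq.surjective z
    obtain ⟨b, hb, hb1⟩ := poincareLeaf_exists_flatAt ξ hX hfin w₀
    have hex : ∀ i : Fin k, ∃ t : ∀ y, (leafSystem X ξ η).fiber y,
        (leafSystem X ξ η).FlatAt t (leafProj X ξ w₀.1) ∧
          ∀ᶠ x in 𝓝 w₀.1, leafVal ξ ⟨x, rfl⟩ (t (leafProj X ξ x)) = Pi.single i (1 : ℂ) :=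
      fun i => exists_flatAt η hl w₀.1 (Pi.single i (1 : ℂ))
    choose t ht ht1 using hex
    have hcont : Continuous fun w : Cover ρ X => w.1 := continuous_fst
    set v := assocVal ⟨w₀, rfl⟩ (φ _ (s (leafProductProj X ξ w₀)))
    refine ⟨k, fun i z => t i (pLeafHat X ξ z), fun i z => v i • b z,
      fun i => ⟨t i, ht i, Filter.Eventually.of_forall fun _ => rfl⟩, fun i w hw => ?_, ?_⟩
    · filter_upwards [hb w hw] with w' hw'
      exact congrArg (v i * ·) hw'
    · rw [← hq.isOpenQuotientMap.map_nhds_eq, Filter.eventually_map]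
      have h1 : ∀ᶠ w in 𝓝 w₀, ∀ i,
          leafVal ξ ⟨w.1, rfl⟩ (t i (leafProj X ξ w.1)) =
            Pi.single i (1 : ℂ) :=
        Filter.eventually_all.2 fun i => hcont.continuousAt.eventually (ht1 i)
      filter_upwards [h w₀ rfl, hb1, h1] with w e1 e2 e3
      apply (φ _).injective
      apply (assocEquiv (expRep ξ η) hq ⟨w, rfl⟩).injective
      rw [assocEquiv_apply, assocEquiv_apply, e1]
      have e4 : ∀ i, poincareVal ξ ⟨w, rfl⟩ (v i • b (leafProductProj X ξ w)) •
          leafVal ξ ⟨w.1, rfl⟩ (t i (leafProj X ξ w.1)) = v i • Pi.single i (1 : ℂ) := by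
        intro i
        rw [map_smul, e2, e3 i, smul_eq_mul, mul_one]
      refine Eq.trans ?_ ((Finset.sum_congr rfl fun i _ => (e4 i).symm).trans
        (hφsum _ ⟨w, rfl⟩ (fun i => t i (leafProj X ξ w.1))
          (fun i => v i • b (leafProductProj X ξ w))).symm)
      change v = ∑ i, v i • Pi.single i (1 : ℂ)
      funext j
      simp [Finset.sum_apply, Pi.single_apply]

/-- The inverse Fourier-Mukai transform of the local system of `η` is the flat bundle of the
representation induced from `(exp ξ, η)`. -/
theorem inverseFM_iso_flatBundle (hX : IsQuotientCoveringMap (baseProj Γ X) Γ)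
    (hfin : (MulAction.orbit Γ ξ).Finite) {k n : ℕ}
    {η : Isotropy ξ →* U k} {τ : Crossed ρ →* U n} (h : IsInd ξ η τ) :
    (inverseFM X ξ (leafSystem X ξ η)).Iso (flatBundle X τ) := by
  have hq := isQuotientCoveringMap_leafProductProj ξ hX hfin
  have hM := isQuotientCoveringMap_coverProj ρ hX
  have := hM.toContinuousConstSMul
  have hfi : (crossedIsotropy ξ).FiniteIndex := finiteIndex_crossedIsotropy hfin
  exact ((tensor_poincareLeaf_iso ξ hX hfin η).push (pLeaf X ξ)).trans
    (push_assoc_iso (crossedIsotropy ξ) (leafProductProj X ξ) (pLeaf X ξ)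
      (fun g w => hq.map_smul g) (fun g w => hM.map_smul g) h)

end FourierMukai

end TorusBundle

end

theorem mainTheorem5 {Γ : Type*} [Group Γ] {X : Type*} [TopologicalSpace X]
    [SimplyConnectedSpace X] [MulAction Γ X]
    (hX : IsQuotientCoveringMap (baseProj Γ X) Γ)
    {d : ℕ} (ρ : Γ →* GL (Fin d) ℤ) (x₀ : X) (n : ℕ) (hn : 1 ≤ n) :
    -- `Γ = π₁(B)`, and `π₁(M)` is the crossed product
    ∃ (eB : Γ ≃* Pi1 (Base Γ X) (baseProj Γ X x₀))
      (eM : Crossed ρ ≃* Pi1 (Total ρ X) (coverProj ρ X (coverPt ρ X x₀))),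
      (∀ (γ : Γ) (p : Path x₀ (γ • x₀)) (l : Path (baseProj Γ X x₀) (baseProj Γ X x₀)),
        (∀ t, l t = baseProj Γ X (p t)) →
          eB γ = MulOpposite.op (FundamentalGroup.fromPath (Path.Homotopic.Quotient.mk l))) ∧
      (∀ (g : Crossed ρ) (p : Path (coverPt ρ X x₀) (g • coverPt ρ X x₀))
        (l : Path (coverProj ρ X (coverPt ρ X x₀)) (coverProj ρ X (coverPt ρ X x₀))),
        (∀ t, l t = coverProj ρ X (p t)) →
          eM g = MulOpposite.op (FundamentalGroup.fromPath (Path.Homotopic.Quotient.mk l))) ∧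
      -- the isotropy group and its crossed product with the lattice have index `ℓ`
      (∀ (ξ : DualTorus ρ) (ℓ : ℕ), Nat.card (MulAction.orbit Γ ξ) = ℓ →
        (Isotropy ξ).index = ℓ ∧ (crossedIsotropy ξ).index = ℓ) ∧
      -- parametrization of the representation variety by induction, for every choice of
      -- representatives of the orbits
      (∀ r : MulAction.orbitRel.Quotient Γ (DualTorus ρ) → DualTorus ρ, (∀ o, r o ∈ o.orbit) →
        ∃ Φ : Params ρ n r ≃ RepVar (Pi1 (Total ρ X) (coverProj ρ X (coverPt ρ X x₀))) n,
          ∀ (o : {o : MulAction.orbitRel.Quotient Γ (DualTorus ρ) // orbitOrder o ∣ n})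
            (η : Isotropy (r o.1) →* U (n / orbitOrder o.1)) (hη : IsIrr η)
            (τ : Pi1 (Total ρ X) (coverProj ρ X (coverPt ρ X x₀)) →* U n),
            IsInd (r o.1) η (τ.comp eM.toMonoidHom) ↔
              ∃ hτ : IsIrr τ, Φ ⟨o, RepVar.mk η hη⟩ = RepVar.mk τ hτ) ∧
      -- the induced representation depends only on the orbit: moving `ξ` to `γ ξ` and transporting
      -- `η` to the conjugate isotropy group does not change it
      (∀ (ξ : DualTorus ρ) (γ : Γ) (k : ℕ) (η : Isotropy ξ →* U k) (η' : Isotropy (γ • ξ) →* U k),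
        (∀ (h : Isotropy ξ) (h' : Isotropy (γ • ξ)), (h' : Γ) = γ * h * γ⁻¹ → η' h' = η h) →
        ∀ τ : Pi1 (Total ρ X) (coverProj ρ X (coverPt ρ X x₀)) →* U n,
          IsInd ξ η (τ.comp eM.toMonoidHom) ↔ IsInd (γ • ξ) η' (τ.comp eM.toMonoidHom)) ∧
      -- the generic case `ℓ = n`, `k = 1` gives exactly the irreducible representations whose
      -- restriction to the lattice has `n` distinct characters
      (∀ τ : Pi1 (Total ρ X) (coverProj ρ X (coverPt ρ X x₀)) →* U n, IsIrr τ →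
        ((fiberCharacters (τ.comp eM.toMonoidHom)).ncard = n ↔
          ∃ (ξ : DualTorus ρ) (η : Isotropy ξ →* U 1),
            Nat.card (MulAction.orbit Γ ξ) = n ∧ IsInd ξ η (τ.comp eM.toMonoidHom))) ∧
      -- induction corresponds to the inverse Fourier-Mukai transform
      (∀ (ξ : DualTorus ρ) (ℓ k : ℕ), Nat.card (MulAction.orbit Γ ξ) = ℓ → ℓ * k = n →
        ∀ (η : Isotropy ξ →* U k) (τ : Pi1 (Total ρ X) (coverProj ρ X (coverPt ρ X x₀)) →* U n),
          IsIrr η → IsInd ξ η (τ.comp eM.toMonoidHom) →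
          (inverseFM X ξ (leafSystem X ξ η)).Iso (flatBundle X (τ.comp eM.toMonoidHom))) := by
  obtain ⟨eB, hB⟩ := exists_mulEquiv_pi1 hX x₀
  obtain ⟨eM, hM⟩ := exists_mulEquiv_pi1 (isQuotientCoveringMap_coverProj ρ hX) (coverPt ρ X x₀)
  refine ⟨eB, eM, hB, hM,
    fun ξ ℓ h => ⟨(index_isotropy ξ).trans h, (index_crossedIsotropy ξ).trans h⟩,
    fun r hr => exists_params_equiv hn r hr eM, fun ξ γ k η η' hη τ => isInd_smul_iff hη _,
    fun τ hτ => ncard_fiberCharacters_eq_iff hn ((isIrr_comp_mulEquiv eM τ).2 hτ),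
    fun ξ ℓ k hℓ hn' η τ _ hind => ?_⟩
  have hℓ0 : Nat.card (MulAction.orbit Γ ξ) ≠ 0 := by
    rintro h0
    rw [← hℓ, h0, zero_mul] at hn'
    omega
  exact inverseFM_iso_flatBundle ξ hX
    (Set.finite_coe_iff.1 (Nat.finite_of_card_ne_zero hℓ0)) hind
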